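/- Let $d\ge 2$, let $(\tau_x)_{x\in\mathbb Z^d}$ be a stationary and ergodic group of measurable transformations of a probability space $(\Omega,\mathscr F,\mathbb P)$, and let $\{C_{x,y}(\omega)\}_{x,y\in\mathbb Z^d}$ be non-negative random variables with $C_{x,y}=C_{y,x}$, $C_{x+z,y+z}(\omega)=C_{x,y}(\tau_z\omega)$ and $\sum_yC_{x,y}\in(0,\infty)$ a.s. Let $\mathcal L^\omega f(x)=\sum_y(f(y)-f(x))C_{x,y}(\omega)$. With $|\cdot|$ the Euclidean norm, put $\tilde\mu_m(\omega)=\sum_z|z|^mC_{0,z}(\omega)$, $\tilde\mu=\tilde\mu_2$, $\tilde\nu(\omega)=\sum_{|z|=1}1/C_{0,z}(\omega)$, and $\mu(x)=\tilde\mu(\tau_x\omega)$, $\mu_m(x)=\tilde\mu_m(\tau_x\omega)$, $\nu(x)=\tilde\nu(\tau_x\omega)$. Let $B_R=\{x\in\mathbb Z^d:|x|\le R\}$ and $Q_{s,R}=[-s,0]\times B_R$. For finite $A\subset\mathbb Z^d$ let $\|f\|_{r,A}=\big(|A|^{-1}\sum_{x\in A}|f(x)|^r\big)^{1/r}$ if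 $r<\infty$, and $\|f\|_{\infty,A}=\max_A|f|$; let $\|u\|_{1,1,Q_{s,R}}=s^{-1}\int_{-s}^0\|u(t,\cdot)\|_{1,B_R}\,dt$. Suppose that $\tilde\mu\in L^p(\mathbb P)$ and $\tilde\nu\in L^q(\mathbb P)$ for some $p,q\in(1,\infty]$ with $$\Big(1-\frac1d\Big)\frac1p+\frac1q\le\frac1d,$$ and that $\tilde\mu_m\in L^p(\mathbb P)$ for some real $m\ge2$. Then there are (non-random) constants $C_4,\kappa_1>0$ and a random variable $N_0=N_0(\omega)>0$ such that, for a.e. $\omega$, the following holds for every integer $n>N_0(\omega)$, every bounded $u:(-4n^2,0]\times\mathbb Z^d\to\mathbb R$ with $\partial_tu(t,x)=\mathcal L^\omega u(t,\cdot)(x)$ for $(t,x)\in(-4n^2,0]\times B_{2n}$, and all $\frac12\le\theta'<\theta<1$: $$\max_{(t,x)\in Q_{\theta'n^2,\theta'n}}|u(t,x)|\le C_4\left(n^{-(m-2)}\sup_{(s,x)\in(-n^2,0]\times\mathbb Z^d}|u(s,x)|+\left(\frac{M_n}{(\theta-\theta')^{m+3}}\right)^{\kappa_1}\|u\|_{1,1,Q_{\theta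 n^2,\theta n}}\right),$$ where $M_n=\|\max\{\mu,1\}\|_{p,B_{\theta n}}\,\|\max\{\mu_m,1\}\|_{p,B_{\theta n}}\,\|\max\{\nu,1\}\|_{q,B_{\theta n}}$. -/

import Mathlib

open MeasureTheory Set
open scoped ENNReal NNReal

noncomputable section

namespace RCM

/-- The standard Euclidean norm `|z|` of a lattice point `z ∈ ℤ^d`. -/
def enorm2 {d : ℕ} (z : Fin d → ℤ) : ℝ :=
  ‖(WithLp.toLp 2 (fun i => (z i : ℝ)) : EuclideanSpace ℝ (Fin d))‖

theorem finite_ball (d : ℕ) (R : ℝ) : {z : Fin d → ℤ | enorm2 z ≤ R}.Finite := by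
  refine (Set.Finite.pi' (t := fun _ : Fin d => Set.Icc (⌈-R⌉) (⌊R⌋))
    (fun _ => Set.finite_Icc _ _)).subset ?_
  intro z hz i
  have h1 : |(z i : ℝ)| ≤ enorm2 z := by
    simpa [enorm2, Real.norm_eq_abs] using
      PiLp.norm_apply_le (WithLp.toLp 2 (fun i => (z i : ℝ)) : EuclideanSpace ℝ (Fin d)) i
  have h2 := abs_le.mp (h1.trans hz)
  exact ⟨Int.ceil_le.mpr h2.1, Int.le_floor.mpr h2.2⟩

/-- The lattice ball `B_R = {z ∈ ℤ^d : |z| ≤ R}`, as a finite set. -/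
def ball (d : ℕ) (R : ℝ) : Finset (Fin d → ℤ) := (finite_ball d R).toFinset

/-- The parabolic cylinder `Q_{s,R} = [-s,0] × B_R`. -/
def cylinder (d : ℕ) (s R : ℝ) : Set (ℝ × (Fin d → ℤ)) :=
  Set.Icc (-s) 0 ×ˢ (ball d R : Set (Fin d → ℤ))

/-- A stationary and ergodic group `(τ_x)`, `x ∈ ℤ^d`, of measurable transformations of the
probability space `(Ω, P)`. (As every `τ_x` is a bijection with inverse `τ_{-x}`, images and
preimages are interchangeable; as `ℤ^d` is countable, joint measurability of `(x, ω) ↦ τ_x ω` is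
measurability of every `τ_x`, which is part of `MeasurePreserving`.) -/
structure IsStationaryErgodic {d : ℕ} {Ω : Type*} [MeasurableSpace Ω] (P : Measure Ω)
    (τ : (Fin d → ℤ) → Ω → Ω) : Prop where
  zero : τ 0 = id
  add : ∀ x y, τ (x + y) = τ x ∘ τ y
  stationary : ∀ x, MeasurePreserving (τ x) P P
  ergodic : ∀ A : Set Ω, MeasurableSet A → (∀ x, τ x ⁻¹' A = A) → P A = 0 ∨ P A = 1

/-- Random conductances: non-negative symmetric random variables `C_{x,y}`, covariant under the
shifts `τ`, with `0 < π_x = ∑_y C_{x,y} < ∞` almost surely. -/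
structure IsConductance {d : ℕ} {Ω : Type*} [MeasurableSpace Ω] (P : Measure Ω)
    (τ : (Fin d → ℤ) → Ω → Ω) (C : (Fin d → ℤ) → (Fin d → ℤ) → Ω → ℝ≥0) : Prop where
  measurable : ∀ x y, Measurable (C x y)
  symm : ∀ x y ω, C x y ω = C y x ω
  shift : ∀ x y z ω, C (x + z) (y + z) ω = C x y (τ z ω)
  total : ∀ x, ∀ᵐ ω ∂P, 0 < ∑' y, (C x y ω : ℝ≥0∞) ∧ ∑' y, (C x y ω : ℝ≥0∞) < ∞

/-- `μ̃_m(ω) = ∑_z |z|^m C_{0,z}(ω)`, with values in `[0,∞]`; `μ̃ = μ̃_2`. -/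
def muTilde {d : ℕ} {Ω : Type*} (C : (Fin d → ℤ) → (Fin d → ℤ) → Ω → ℝ≥0) (m : ℝ) (ω : Ω) :
    ℝ≥0∞ :=
  ∑' z : Fin d → ℤ, ENNReal.ofReal (enorm2 z ^ m) * (C 0 z ω : ℝ≥0∞)

/-- `ν̃(ω) = ∑_{|z| = 1} 1 / C_{0,z}(ω)`, with values in `[0,∞]` and `1 / 0 = ∞`. -/
def nuTilde {d : ℕ} {Ω : Type*} (C : (Fin d → ℤ) → (Fin d → ℤ) → Ω → ℝ≥0) (ω : Ω) : ℝ≥0∞ :=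
  ∑' z : {z : Fin d → ℤ // enorm2 z = 1}, (C 0 z ω : ℝ≥0∞)⁻¹

/-- `μ_m(x, ω) = μ̃_m(τ_x ω)`, as a real number; `μ = μ_2`. -/
def mu {d : ℕ} {Ω : Type*} (τ : (Fin d → ℤ) → Ω → Ω)
    (C : (Fin d → ℤ) → (Fin d → ℤ) → Ω → ℝ≥0) (m : ℝ) (x : Fin d → ℤ) (ω : Ω) : ℝ :=
  (muTilde C m (τ x ω)).toReal

/-- `ν(x, ω) = ν̃(τ_x ω)`, as a real number. -/
def nu {d : ℕ} {Ω : Type*} (τ : (Fin d → ℤ) → Ω → Ω)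
    (C : (Fin d → ℤ) → (Fin d → ℤ) → Ω → ℝ≥0) (x : Fin d → ℤ) (ω : Ω) : ℝ :=
  (nuTilde C (τ x ω)).toReal

/-- The averaged norm `‖f‖_{r,A}` over a finite set `A`: `(|A|⁻¹ ∑_{x ∈ A} |f x|^r)^{1/r}` for
`r < ∞`, and the maximum of `|f|` over `A` for `r = ∞`. -/
def avgNorm {d : ℕ} (r : ℝ≥0∞) (A : Finset (Fin d → ℤ)) (f : (Fin d → ℤ) → ℝ) : ℝ :=
  if r = ∞ then ⨆ x : A, |f x|
  else ((A.card : ℝ)⁻¹ * ∑ x ∈ A, |f x| ^ r.toReal) ^ (1 / r.toReal)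

/-- The averaged space-time norm `‖u‖_{1,1,Q_{s,R}}` over the cylinder `Q_{s,R} = [-s,0] × B_R`. -/
def stNorm {d : ℕ} (s R : ℝ) (u : ℝ → (Fin d → ℤ) → ℝ) : ℝ :=
  s⁻¹ * ∫ t in (-s)..0, avgNorm 1 (ball d R) (u t)

/-- `sup {|u(t,x)| : t ∈ (-s,0], x ∈ ℤ^d}`. -/
def supNorm {d : ℕ} (s : ℝ) (u : ℝ → (Fin d → ℤ) → ℝ) : ℝ :=
  sSup ((fun z : ℝ × (Fin d → ℤ) => |u z.1 z.2|) '' (Set.Ioc (-s) 0 ×ˢ Set.univ))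

/-- `‖max{μ,1}‖_{p,B_R} ‖max{μ_m,1}‖_{p,B_R} ‖max{ν,1}‖_{q,B_R}`. -/
def M {d : ℕ} {Ω : Type*} (τ : (Fin d → ℤ) → Ω → Ω)
    (C : (Fin d → ℤ) → (Fin d → ℤ) → Ω → ℝ≥0) (p q : ℝ≥0∞) (m R : ℝ) (ω : Ω) : ℝ :=
  avgNorm p (ball d R) (fun x => max (mu τ C 2 x ω) 1) *
    avgNorm p (ball d R) (fun x => max (mu τ C m x ω) 1) *
    avgNorm q (ball d R) (fun x => max (nu τ C x ω) 1)

/-- The generator `L^ω f(x) = ∑_y (f(y) - f(x)) C_{x,y}(ω)`. -/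
def gen {d : ℕ} {Ω : Type*} (C : (Fin d → ℤ) → (Fin d → ℤ) → Ω → ℝ≥0) (ω : Ω)
    (f : (Fin d → ℤ) → ℝ) (x : Fin d → ℤ) : ℝ :=
  ∑' y, (f y - f x) * (C x y ω : ℝ)

/-- `u : (-s,0] × ℤ^d → ℝ` satisfies `∂_t u - L^ω u = 0` on `(-s,0] × B_R` (with the left
derivative at the final time `t = 0`). -/
def IsCaloric {d : ℕ} {Ω : Type*} (C : (Fin d → ℤ) → (Fin d → ℤ) → Ω → ℝ≥0) (ω : Ω)
    (s R : ℝ) (u : ℝ → (Fin d → ℤ) → ℝ) : Prop :=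
  ∀ t ∈ Set.Ioc (-s) 0, ∀ x ∈ ball d R,
    HasDerivWithinAt (fun r => u r x) (gen C ω (u t) x) (Set.Ioc (-s) 0) t

end RCM

end

namespace RCM

/-! ### Euclidean norm and balls on the lattice -/

section Lattice

variable {d : ℕ}

/-! The statement is deterministic once the moments at all sites are finite, and it is proved by a
De Giorgi iteration. Put `W = max(μ_m, 1)` and `N = max(ν, 1)`. As `p > 1`, the exponent condition
gives `1/p + 1/q < 2/d`, so there are positive `a ≥ 1/p`, `b ≥ 1/q` with `ε = 2/d - a - b > 0`.

The Sobolev inequality with resistances (`IsDominated.weighted_sobolev`) bounds the `ℓ^ρ` norm of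
`w²`, `1/ρ = 1 - 2/d + b`, by the `ℓ^{1/b}` norm of `N` times the Dirichlet energy. Since `a + 1/ρ +
ε = 1`, Hölder's inequality turns this into a gain of integrability, from power 2 to `2 + 2ε`, even
against the weight `W`. In the other direction `IsDominated.caccioppoli` controls the energy of a
truncated, cut-off solution by its `W`-weighted `L²` mass. The nonlocal part costs only `U δ^{-m}
W`, where `U` is the global bound: a jump over distance `δ` is paid for by the `m`-th moment.
Together with `energy_estimate` in time this yields the superlinear recursion
`IsDominated.mass_step` for the mass of `(u - k)₊²` over shrinking cylinders and rising levels.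

On scale `n` the tail is harmless as soon as the final level `kk` is at least `U n^{-(m-2)}`, which
produces the first term of the bound. If the initial mass is small relative to `kk`, the masses tend
to zero and `u ≤ kk` (`IsDominated.le_of_small_mass`). Interpolating the initial mass between the
supremum `S` on a larger cylinder and the `L¹` norm gives an admissible `kk` that contains `S / 2`
(`IsDominated.le_of_bounded`). That half is absorbed by iterating over cylinders
(`le_of_half_absorption`), and working with both `u` and `-u` gives
`IsDominated.maximal_inequality`.

Randomness enters only through almost sure finiteness of the moments at every translate of the
environment. -/

theorem enorm2_nonneg (z : Fin d → ℤ) : 0 ≤ enorm2 z := norm_nonneg _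

theorem enorm2_zero : enorm2 (0 : Fin d → ℤ) = 0 := by
  simp only [enorm2, Pi.zero_apply, Int.cast_zero]
  exact norm_zero (E := EuclideanSpace ℝ (Fin d))

theorem enorm2_neg (z : Fin d → ℤ) : enorm2 (-z) = enorm2 z := by
  unfold enorm2
  rw [← norm_neg]
  congr 1
  ext i
  simp

theorem enorm2_sub_comm (x y : Fin d → ℤ) : enorm2 (x - y) = enorm2 (y - x) := by
  rw [← enorm2_neg, neg_sub]

theorem enorm2_add_le (x y : Fin d → ℤ) : enorm2 (x + y) ≤ enorm2 x + enorm2 y := by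
  unfold enorm2
  refine le_trans (le_of_eq ?_) (norm_add_le _ _)
  congr 1
  ext i
  simp

theorem abs_enorm2_sub_le (x y : Fin d → ℤ) : |enorm2 x - enorm2 y| ≤ enorm2 (y - x) := by
  have h1 := enorm2_add_le (x - y) y
  have h2 := enorm2_add_le (y - x) x
  rw [sub_add_cancel] at h1 h2
  rw [enorm2_sub_comm] at h1
  exact abs_le.2 ⟨by linarith, by linarith⟩

theorem abs_apply_le_enorm2 (z : Fin d → ℤ) (i : Fin d) : |(z i : ℝ)| ≤ enorm2 z := by
  simpa [enorm2, Real.norm_eq_abs] using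
    PiLp.norm_apply_le (WithLp.toLp 2 (fun i => (z i : ℝ)) : EuclideanSpace ℝ (Fin d)) i

theorem one_le_enorm2 {z : Fin d → ℤ} (hz : z ≠ 0) : 1 ≤ enorm2 z := by
  obtain ⟨i, hi⟩ := Function.ne_iff.1 hz
  refine le_trans ?_ (abs_apply_le_enorm2 z i)
  exact_mod_cast Int.one_le_abs hi

theorem enorm2_rpow_le_rpow {r s : ℝ} (hr : 0 < r) (hrs : r ≤ s) (z : Fin d → ℤ) :
    enorm2 z ^ r ≤ enorm2 z ^ s := by
  rcases eq_or_ne z 0 with rfl | hz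
  · rw [enorm2_zero, Real.zero_rpow hr.ne', Real.zero_rpow (hr.trans_le hrs).ne']
  · exact Real.rpow_le_rpow_of_exponent_le (one_le_enorm2 hz) hrs

theorem enorm2_single (i : Fin d) : enorm2 (Pi.single i 1 : Fin d → ℤ) = 1 := by
  have : (WithLp.toLp 2 (fun j => ((Pi.single i 1 : Fin d → ℤ) j : ℝ)) :
      EuclideanSpace ℝ (Fin d)) = EuclideanSpace.single i 1 := by
    ext j
    by_cases h : j = i
    · subst h; simp
    · simp [h]
  rw [enorm2, this]
  simp

theorem mem_ball {R : ℝ} {z : Fin d → ℤ} : z ∈ ball d R ↔ enorm2 z ≤ R := by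
  simp [ball]

theorem ball_mono {R S : ℝ} (h : R ≤ S) : ball d R ⊆ ball d S := fun _ hz =>
  mem_ball.2 ((mem_ball.1 hz).trans h)

theorem card_ball_pos {R : ℝ} (hR : 0 ≤ R) : 0 < (ball d R).card :=
  Finset.card_pos.2 ⟨0, mem_ball.2 (by rwa [enorm2_zero])⟩

theorem card_ball_le {n : ℕ} (hn : 1 ≤ n) {R : ℝ} (hR : R ≤ n) :
    ((ball d R).card : ℝ) ≤ (3 * n : ℝ) ^ d := by
  have hsub : ball d R ⊆ Fintype.piFinset fun _ : Fin d => Finset.Icc (-(n : ℤ)) n := by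
    intro z hz
    rw [Fintype.mem_piFinset]
    intro i
    have h1 := (abs_apply_le_enorm2 z i).trans ((mem_ball.1 hz).trans hR)
    rw [Finset.mem_Icc, ← abs_le]
    exact_mod_cast h1
  have h2 := Finset.card_le_card hsub
  rw [Fintype.card_piFinset] at h2
  have h3 : (Finset.Icc (-(n : ℤ)) n).card ≤ 3 * n := by
    rw [Int.card_Icc]; omega
  have h4 : (ball d R).card ≤ (3 * n) ^ d := by
    refine h2.trans ?_
    simpa using Nat.pow_le_pow_left h3 d
  exact_mod_cast h4

end Lattice

/-! ### Deterministic conductances with moment bounds -/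

/-- A symmetric conductance on `ℤ^d` whose `m`-th moments are dominated by `W` and whose
nearest-neighbour resistances are dominated by `N`. -/
structure IsDominated {d : ℕ} (c : (Fin d → ℤ) → (Fin d → ℤ) → ℝ) (m : ℝ)
    (W N : (Fin d → ℤ) → ℝ) : Prop where
  two_le : 2 ≤ m
  nonneg : ∀ x y, 0 ≤ c x y
  symm : ∀ x y, c x y = c y x
  summable : ∀ x, Summable fun y => enorm2 (y - x) ^ m * c x y
  tsum_le : ∀ x, ∑' y, enorm2 (y - x) ^ m * c x y ≤ W x
  one_le_left : ∀ x, 1 ≤ W x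
  one_le_right : ∀ x, 1 ≤ N x
  pos : ∀ x y, enorm2 (y - x) = 1 → 0 < c x y
  inv_le : ∀ x y, enorm2 (y - x) = 1 → (c x y)⁻¹ ≤ N x

namespace IsDominated

variable {d : ℕ} {c : (Fin d → ℤ) → (Fin d → ℤ) → ℝ} {m : ℝ} {W N : (Fin d → ℤ) → ℝ}

theorem summable_conductance (h : IsDominated c m W N) (x : Fin d → ℤ) : Summable (c x) := by
  classical
  have h1 : Summable fun y => if y = x then c x x else 0 :=
    (hasSum_ite_eq x (c x x)).summable
  refine Summable.of_nonneg_of_le (h.nonneg x) (fun y => ?_) (h1.add (h.summable x))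
  have hnn : 0 ≤ enorm2 (y - x) ^ m * c x y :=
    mul_nonneg (Real.rpow_nonneg (enorm2_nonneg _) _) (h.nonneg _ _)
  by_cases hy : y = x
  · subst hy; simpa using hnn
  · have : 1 ≤ enorm2 (y - x) ^ m :=
      Real.one_le_rpow (one_le_enorm2 (sub_ne_zero.2 hy)) (by linarith [h.two_le])
    simpa [hy] using le_mul_of_one_le_left (h.nonneg x y) this

theorem sum_sq_le (h : IsDominated c m W N) (x : Fin d → ℤ) (s : Finset (Fin d → ℤ)) :
    ∑ y ∈ s, enorm2 (y - x) ^ 2 * c x y ≤ W x := by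
  refine le_trans ?_ ((h.summable x).sum_le_tsum s (fun y _ =>
    mul_nonneg (Real.rpow_nonneg (enorm2_nonneg _) _) (h.nonneg _ _)) |>.trans (h.tsum_le x))
  refine Finset.sum_le_sum fun y _ => mul_le_mul_of_nonneg_right ?_ (h.nonneg _ _)
  rw [← Real.rpow_natCast]
  exact enorm2_rpow_le_rpow (by norm_num) (by exact_mod_cast h.two_le) _

theorem left_nonneg (h : IsDominated c m W N) (x : Fin d → ℤ) : 0 ≤ W x :=
  zero_le_one.trans (h.one_le_left x)

theorem right_nonneg (h : IsDominated c m W N) (x : Fin d → ℤ) : 0 ≤ N x :=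
  zero_le_one.trans (h.one_le_right x)

end IsDominated

/-! ### The isotropic `ℓ¹` Sobolev inequality -/

section Sobolev

theorem lintegral_pi_count {d : ℕ} (f : (Fin d → ℤ) → ℝ≥0∞) :
    ∫⁻ x, f x ∂(Measure.pi fun _ : Fin d => (Measure.count : Measure ℤ)) = ∑' x, f x := by
  rw [lintegral_countable']
  refine tsum_congr fun x => ?_
  rw [Measure.pi_singleton]
  simp

/-- The `ℓ¹` discrete gradient at `x`. -/
def gradNorm {d : ℕ} (g : (Fin d → ℤ) → ℝ) (x : Fin d → ℤ) : ℝ :=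
  ∑ i, |g (x + Pi.single i 1) - g x|

theorem gradNorm_nonneg {d : ℕ} (g : (Fin d → ℤ) → ℝ) (x : Fin d → ℤ) : 0 ≤ gradNorm g x :=
  Finset.sum_nonneg fun _ _ => abs_nonneg _

theorem ofReal_abs_le_tsum_diff {h : ℤ → ℝ} (hfin : (Function.support h).Finite) (t : ℤ) :
    ENNReal.ofReal |h t| ≤ ∑' s : ℤ, ENNReal.ofReal |h (s + 1) - h s| := by
  obtain ⟨b, hb⟩ := hfin.bddAbove
  obtain ⟨k, hk⟩ : ∃ k : ℕ, h (t + k) = 0 := by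
    refine ⟨(b - t).toNat + 1, ?_⟩
    by_contra hne
    have := hb hne
    push_cast at this
    omega
  have h1 : |h t| ≤ ∑ j ∈ Finset.range k, |h (t + j + 1) - h (t + j)| := by
    have h2 := Finset.sum_range_sub (fun j : ℕ => h (t + j)) k
    simp only [Nat.cast_zero, add_zero, hk, zero_sub] at h2
    rw [← abs_neg, ← h2]
    refine (Finset.abs_sum_le_sum_abs _ _).trans (le_of_eq ?_)
    refine Finset.sum_congr rfl fun j _ => ?_
    push_cast
    rw [add_assoc]
  calc ENNReal.ofReal |h t|
      ≤ ENNReal.ofReal (∑ j ∈ Finset.range k, |h (t + j + 1) - h (t + j)|) :=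
        ENNReal.ofReal_le_ofReal h1
    _ = ∑ j ∈ Finset.range k, ENNReal.ofReal |h (t + j + 1) - h (t + j)| :=
        ENNReal.ofReal_sum_of_nonneg fun _ _ => abs_nonneg _
    _ ≤ ∑' j : ℕ, ENNReal.ofReal |h (t + j + 1) - h (t + j)| := ENNReal.sum_le_tsum _
    _ ≤ ∑' s : ℤ, ENNReal.ofReal |h (s + 1) - h s| :=
        ENNReal.tsum_comp_le_tsum_of_injective (f := fun j : ℕ => t + (j : ℤ))
          (fun i j hij => by simpa using hij) fun s => ENNReal.ofReal |h (s + 1) - h s|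

/-- The discrete Gagliardo–Nirenberg–Sobolev inequality on `ℤ^d`. -/
theorem tsum_rpow_le_tsum_gradNorm {d : ℕ} (hd : 2 ≤ d) {g : (Fin d → ℤ) → ℝ}
    (hg : (Function.support g).Finite) :
    ∑' x, ENNReal.ofReal |g x| ^ ((d : ℝ) / (d - 1)) ≤
      (∑' x, ENNReal.ofReal (gradNorm g x)) ^ ((d : ℝ) / (d - 1)) := by
  have hd1 : (1 : ℝ) < d := by exact_mod_cast hd
  have hconj : Real.HolderConjugate (Fintype.card (Fin d) : ℝ) ((d : ℝ) / (d - 1)) := by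
    rw [Fintype.card_fin]
    exact Real.HolderConjugate.conjExponent hd1
  have key := lintegral_prod_lintegral_pow_le (A := fun _ : Fin d => ℤ)
    (fun _ : Fin d => (Measure.count : Measure ℤ)) hconj
    (f := fun x => ENNReal.ofReal (gradNorm g x)) (measurable_of_countable _)
  rw [lintegral_pi_count, lintegral_pi_count] at key
  refine le_trans (ENNReal.tsum_le_tsum fun x => ?_) key
  -- Each of the `d` coordinate lines through `x` bounds `|g x|` by its own gradient sum. Raising
  -- each bound to the power `1/(d-1)` and multiplying gives the integrand of the product inequality
  -- `key`.
  have hline : ∀ i : Fin d, ENNReal.ofReal |g x| ≤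
      ∫⁻ t, ENNReal.ofReal (gradNorm g (Function.update x i t)) ∂(Measure.count : Measure ℤ) := by
    intro i
    rw [lintegral_count]
    have hinj : Function.Injective fun t : ℤ => Function.update x i t :=
      Function.update_injective x i
    have h1 := ofReal_abs_le_tsum_diff (h := fun t => g (Function.update x i t))
      (hg.preimage hinj.injOn) (x i)
    rw [Function.update_eq_self] at h1
    refine h1.trans (ENNReal.tsum_le_tsum fun t => ENNReal.ofReal_le_ofReal ?_)
    have h2 : Function.update x i (t + 1) = Function.update x i t + Pi.single i 1 := by
      ext j
      by_cases hj : j = i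
      · subst hj; simp
      · simp [hj]
    rw [h2]
    exact Finset.single_le_sum (f := fun j =>
      |g (Function.update x i t + Pi.single j 1) - g (Function.update x i t)|)
      (fun _ _ => abs_nonneg _) (Finset.mem_univ i)
  have hpos : (0 : ℝ) < d - 1 := by linarith
  calc ENNReal.ofReal |g x| ^ ((d : ℝ) / (d - 1))
      = ∏ _i : Fin d, ENNReal.ofReal |g x| ^ ((1 : ℝ) / (d - 1)) := by
        rw [Finset.prod_const, Finset.card_univ, Fintype.card_fin, ← ENNReal.rpow_natCast,
          ← ENNReal.rpow_mul]
        congr 1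
        field_simp
    _ ≤ _ := by
        rw [Fintype.card_fin]
        exact Finset.prod_le_prod' fun i _ =>
          ENNReal.rpow_le_rpow (hline i) (by positivity)

theorem sum_rpow_le_sum_gradNorm {d : ℕ} (hd : 2 ≤ d) {g : (Fin d → ℤ) → ℝ}
    {B Λ : Finset (Fin d → ℤ)} (hg : ∀ x ∉ B, g x = 0)
    (hB : B ⊆ Λ) (hnb : ∀ x ∈ B, ∀ i, x - Pi.single i 1 ∈ Λ) :
    (∑ x ∈ B, |g x| ^ ((d : ℝ) / (d - 1))) ^ (((d : ℝ) - 1) / d) ≤ ∑ x ∈ Λ, gradNorm g x := by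
  have hd1 : (1 : ℝ) < d := by exact_mod_cast hd
  have hpos : (0 : ℝ) < d - 1 := by linarith
  have hexp : (0 : ℝ) < (d : ℝ) / (d - 1) := by positivity
  have hfin : (Function.support g).Finite :=
    B.finite_toSet.subset fun x hx => by_contra fun h => hx (hg x h)
  have key := tsum_rpow_le_tsum_gradNorm hd hfin
  have hgrad : ∀ x ∉ Λ, gradNorm g x = 0 := by
    intro x hx
    refine Finset.sum_eq_zero fun i _ => ?_
    have h1 : x + Pi.single i 1 ∉ B := fun h => hx (by simpa using hnb _ h i)
    rw [hg x fun h => hx (hB h), hg _ h1]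
    simp
  rw [tsum_eq_sum (s := B) (fun x hx => by simp [hg x hx, hexp]),
    tsum_eq_sum (s := Λ) (fun x hx => by rw [hgrad x hx, ENNReal.ofReal_zero]),
    ← ENNReal.ofReal_sum_of_nonneg (fun x _ => gradNorm_nonneg g x)] at key
  simp_rw [ENNReal.ofReal_rpow_of_nonneg (abs_nonneg _) hexp.le] at key
  have hS : 0 ≤ ∑ x ∈ Λ, gradNorm g x := Finset.sum_nonneg fun x _ => gradNorm_nonneg g x
  rw [← ENNReal.ofReal_sum_of_nonneg (fun x _ => Real.rpow_nonneg (abs_nonneg _) _),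
    ENNReal.ofReal_rpow_of_nonneg hS hexp.le,
    ENNReal.ofReal_le_ofReal_iff (Real.rpow_nonneg hS _)] at key
  have h2 := Real.rpow_le_rpow (Finset.sum_nonneg fun x _ => Real.rpow_nonneg (abs_nonneg _) _)
    key (show 0 ≤ ((d : ℝ) - 1) / d by positivity)
  rwa [← Real.rpow_mul hS, show (d : ℝ) / (d - 1) * ((d - 1) / d) = 1 by field_simp,
    Real.rpow_one] at h2

end Sobolev

/-! ### Sobolev inequality with resistances -/

section WeightedSobolev

/-- Bernoulli's inequality at `x / y`, multiplied by `y ^ s`. -/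
theorem rpow_sub_rpow_le_mul {x y s : ℝ} (hx : 0 ≤ x) (hxy : x ≤ y) (hs : 1 ≤ s) :
    y ^ s - x ^ s ≤ s * (y - x) * y ^ (s - 1) := by
  rcases hx.trans hxy |>.eq_or_lt with hy | hy
  · obtain rfl : x = 0 := by linarith
    subst hy; simp
  · have h1 := one_add_mul_self_le_rpow_one_add (s := x / y - 1)
      (by linarith [div_nonneg hx hy.le]) hs
    rw [add_sub_cancel, Real.div_rpow hx hy.le, le_div_iff₀ (Real.rpow_pos_of_pos hy s)] at h1
    have h2 : y ^ s = y ^ (s - 1) * y := by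
      rw [← Real.rpow_add_one hy.ne', sub_add_cancel]
    have h3 : (1 + s * (x / y - 1)) * y ^ s = y ^ s + s * (x - y) * y ^ (s - 1) := by
      rw [h2]; field_simp
    rw [h3] at h1
    nlinarith

theorem abs_rpow_sub_rpow_le_mul {x y s : ℝ} (hx : 0 ≤ x) (hy : 0 ≤ y) (hs : 1 ≤ s) :
    |y ^ s - x ^ s| ≤ s * (|y - x| * (y ^ (s - 1) + x ^ (s - 1))) := by
  have hx1 := Real.rpow_nonneg hx (s - 1)
  have hy1 := Real.rpow_nonneg hy (s - 1)
  rcases le_total x y with h | h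
  · rw [abs_of_nonneg (sub_nonneg.2 (Real.rpow_le_rpow hx h (by linarith))),
      abs_of_nonneg (sub_nonneg.2 h)]
    have := rpow_sub_rpow_le_mul hx h hs
    have : 0 ≤ s * (y - x) * x ^ (s - 1) :=
      mul_nonneg (mul_nonneg (by linarith) (by linarith)) hx1
    linarith
  · rw [abs_of_nonpos (sub_nonpos.2 (Real.rpow_le_rpow hy h (by linarith))),
      abs_of_nonpos (sub_nonpos.2 h)]
    have := rpow_sub_rpow_le_mul hy h hs
    have : 0 ≤ s * (x - y) * y ^ (s - 1) :=
      mul_nonneg (mul_nonneg (by linarith) (by linarith)) hy1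
    linarith

theorem sum_shift_le {d : ℕ} {h : (Fin d → ℤ) → ℝ} (hnn : ∀ x, 0 ≤ h x)
    {B : Finset (Fin d → ℤ)} (hB : ∀ x ∉ B, h x = 0) (Λ : Finset (Fin d → ℤ)) (e : Fin d → ℤ) :
    ∑ x ∈ Λ, h (x + e) ≤ ∑ x ∈ B, h x := by
  classical
  rw [← Finset.sum_image (s := Λ) (g := fun x => x + e) (f := h)
    (fun x _ y _ hxy => by simpa using hxy)]
  rw [← Finset.sum_filter_of_ne (p := (· ∈ B)) fun x _ hx => by_contra fun hxB => hx (hB x hxB)]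
  exact Finset.sum_le_sum_of_subset_of_nonneg (fun x hx => (Finset.mem_filter.1 hx).2)
    fun x _ _ => hnn x

variable {d : ℕ} {c : (Fin d → ℤ) → (Fin d → ℤ) → ℝ} {m : ℝ} {W N : (Fin d → ℤ) → ℝ}

/-- The Dirichlet energy of `w` restricted to pairs in `Λ`. -/
def energy {d : ℕ} (c : (Fin d → ℤ) → (Fin d → ℤ) → ℝ) (Λ : Finset (Fin d → ℤ))
    (w : (Fin d → ℤ) → ℝ) : ℝ :=
  ∑ x ∈ Λ, ∑ y ∈ Λ, c x y * (w x - w y) ^ 2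

theorem IsDominated.energy_nonneg (h : IsDominated c m W N) (Λ : Finset (Fin d → ℤ))
    (w : (Fin d → ℤ) → ℝ) : 0 ≤ energy c Λ w :=
  Finset.sum_nonneg fun _ _ => Finset.sum_nonneg fun _ _ => mul_nonneg (h.nonneg _ _) (sq_nonneg _)

theorem IsDominated.sum_nearest_le_energy (h : IsDominated c m W N)
    {B Λ : Finset (Fin d → ℤ)} {w : (Fin d → ℤ) → ℝ} (hw : ∀ x ∉ B, w x = 0) (hB : B ⊆ Λ)
    (hnb : ∀ x ∈ B, ∀ i, x + Pi.single i 1 ∈ Λ) :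
    ∑ x ∈ Λ, ∑ i, c x (x + Pi.single i 1) * (w (x + Pi.single i 1) - w x) ^ 2 ≤
      d * energy c Λ w := by
  rw [energy, Finset.mul_sum]
  refine Finset.sum_le_sum fun x hx => ?_
  have hone : ∀ i ∈ (Finset.univ : Finset (Fin d)),
      c x (x + Pi.single i 1) * (w (x + Pi.single i 1) - w x) ^ 2 ≤
        ∑ y ∈ Λ, c x y * (w x - w y) ^ 2 := by
    intro i _
    have hnn : ∀ y ∈ Λ, 0 ≤ c x y * (w x - w y) ^ 2 := fun y _ =>
      mul_nonneg (h.nonneg _ _) (sq_nonneg _)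
    by_cases hy : x + Pi.single i 1 ∈ Λ
    · rw [show (w (x + Pi.single i 1) - w x) ^ 2 = (w x - w (x + Pi.single i 1)) ^ 2 by ring]
      exact Finset.single_le_sum hnn hy
    · refine le_trans (le_of_eq ?_) (Finset.sum_nonneg hnn)
      rw [hw x fun hxB => hy (hnb x hxB i), hw _ fun h => hy (hB h)]
      simp
  refine (Finset.sum_le_card_nsmul _ _ _ hone).trans (le_of_eq ?_)
  simp

/-- Apply the `ℓ¹` Sobolev inequality to `w ^ s`. By Cauchy–Schwarz its gradient sum is at most the
root of the energy times the root of a resistance-weighted sum of `w ^ (2(s-1))`. Hölder's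
inequality splits the latter into the norm of `N` and a power of the left-hand sum, which is then
cancelled. -/
theorem IsDominated.weighted_sobolev (h : IsDominated c m W N) (hd : 2 ≤ d) {b ρ : ℝ}
    (hb : 0 < b) (hb1 : b < 1) (hρ : 0 < ρ) (hρb : ρ⁻¹ = 1 - 2 / d + b)
    {B Λ : Finset (Fin d → ℤ)} {w : (Fin d → ℤ) → ℝ} (hw0 : ∀ x, 0 ≤ w x)
    (hw : ∀ x ∉ B, w x = 0) (hB : B ⊆ Λ)
    (hnb : ∀ x ∈ B, ∀ i, x + Pi.single i 1 ∈ Λ) (hnb' : ∀ x ∈ B, ∀ i, x - Pi.single i 1 ∈ Λ) :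
    (∑ x ∈ B, w x ^ (2 * ρ)) ^ ρ⁻¹ ≤
      (2 * d * (1 + ρ * (1 - b))) ^ 2 * (∑ x ∈ B, N x ^ b⁻¹) ^ b * energy c Λ w := by
  have hd1 : (1 : ℝ) < d := by exact_mod_cast hd
  have hdpos : (0 : ℝ) < d - 1 := by linarith
  -- This `s` meets two requirements at once: `s d/(d-1) = 2ρ` on the Sobolev side and `2(s-1)/(1-b)
  -- = 2ρ` on the Hölder side, so the same sum `X` appears in both.
  set s := 1 + ρ * (1 - b) with hs
  have hs1 : 1 < s := by
    have : 0 < ρ * (1 - b) := mul_pos hρ (by linarith)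
    linarith
  set X := ∑ x ∈ B, w x ^ (2 * ρ) with hX
  set E := energy c Λ w with hE
  set Q := (∑ x ∈ B, N x ^ b⁻¹) ^ b with hQ
  have hX0 : 0 ≤ X := Finset.sum_nonneg fun x _ => Real.rpow_nonneg (hw0 x) _
  have hE0 : 0 ≤ E := h.energy_nonneg _ _
  have hQ0 : 0 ≤ Q := Real.rpow_nonneg
    (Finset.sum_nonneg fun x _ => Real.rpow_nonneg (h.right_nonneg x) _) _
  have hρ1 : ρ * (1 - 2 / d + b) = 1 := by rw [← hρb, mul_inv_cancel₀ hρ.ne']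
  have hsd : s * ((d : ℝ) / (d - 1)) = 2 * ρ := by
    rw [hs, mul_div_assoc', div_eq_iff hdpos.ne']
    field_simp at hρ1
    linear_combination -hρ1
  set r : (Fin d → ℤ) → Fin d → ℝ := fun x i =>
    |w (x + Pi.single i 1) - w x| * (w (x + Pi.single i 1) ^ (s - 1) + w x ^ (s - 1)) with hr
  set G := ∑ x ∈ Λ, ∑ i, r x i with hG
  have hr0 : ∀ x i, 0 ≤ r x i := fun x i => mul_nonneg (abs_nonneg _)
    (add_nonneg (Real.rpow_nonneg (hw0 _) _) (Real.rpow_nonneg (hw0 _) _))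
  have hG0 : 0 ≤ G := Finset.sum_nonneg fun x _ => Finset.sum_nonneg fun i _ => hr0 x i
  set R := ∑ x ∈ B, N x * w x ^ (2 * (s - 1)) with hR
  have h1 : X ^ (((d : ℝ) - 1) / d) ≤ s * G := by
    have h2 := sum_rpow_le_sum_gradNorm hd (g := fun x => w x ^ s) (B := B) (Λ := Λ)
      (fun x hx => by simp only [hw x hx]; exact Real.zero_rpow (by linarith)) hB hnb'
    have h3 : ∑ x ∈ B, |w x ^ s| ^ ((d : ℝ) / (d - 1)) = X := by
      refine Finset.sum_congr rfl fun x _ => ?_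
      rw [abs_of_nonneg (Real.rpow_nonneg (hw0 x) _), ← Real.rpow_mul (hw0 x), hsd]
    rw [h3] at h2
    refine h2.trans ?_
    rw [hG, Finset.mul_sum]
    refine Finset.sum_le_sum fun x _ => ?_
    rw [gradNorm, Finset.mul_sum]
    exact Finset.sum_le_sum fun i _ => abs_rpow_sub_rpow_le_mul (hw0 _) (hw0 _) hs1.le
  have hunit : ∀ (x : Fin d → ℤ) (i : Fin d), enorm2 (x + Pi.single i 1 - x) = 1 := fun x i => by
    rw [add_sub_cancel_left, enorm2_single]
  have hunit' : ∀ (x : Fin d → ℤ) (i : Fin d), enorm2 (x - (x + Pi.single i 1)) = 1 := fun x i => by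
    rw [enorm2_sub_comm, hunit]
  have h4 : G ^ 2 ≤ (d * E) * (4 * d * R) := by
    have hcs : G ^ 2 ≤
        (∑ x ∈ Λ, ∑ i, c x (x + Pi.single i 1) * (w (x + Pi.single i 1) - w x) ^ 2) *
        (∑ x ∈ Λ, ∑ i, (c x (x + Pi.single i 1))⁻¹ *
          (w (x + Pi.single i 1) ^ (s - 1) + w x ^ (s - 1)) ^ 2) := by
      rw [hG, ← Finset.sum_product', ← Finset.sum_product', ← Finset.sum_product']
      refine Finset.sum_sq_le_sum_mul_sum_of_sq_le_mul _ ?_ ?_ ?_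
      · exact fun z _ => mul_nonneg (h.nonneg _ _) (sq_nonneg _)
      · exact fun z _ => mul_nonneg (inv_nonneg.2 (h.nonneg _ _)) (sq_nonneg _)
      · intro z _
        have := h.pos _ _ (hunit z.1 z.2)
        simp only [hr]
        refine le_of_eq ?_
        rw [mul_pow, sq_abs]
        field_simp
    have hM0 : ∀ x, 0 ≤ N x * w x ^ (2 * (s - 1)) := fun x =>
      mul_nonneg (h.right_nonneg x) (Real.rpow_nonneg (hw0 x) _)
    have hMB : ∀ x ∉ B, N x * w x ^ (2 * (s - 1)) = 0 := fun x hx => by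
      rw [hw x hx, Real.zero_rpow (by linarith), mul_zero]
    have hres : ∑ x ∈ Λ, ∑ i, (c x (x + Pi.single i 1))⁻¹ *
          (w (x + Pi.single i 1) ^ (s - 1) + w x ^ (s - 1)) ^ 2 ≤ 4 * d * R := by
      have hsq : ∀ x, (w x ^ (s - 1)) ^ 2 = w x ^ (2 * (s - 1)) := fun x => by
        rw [← Real.rpow_natCast, ← Real.rpow_mul (hw0 x)]
        congr 1
        push_cast; ring
      calc _ ≤ ∑ x ∈ Λ, ∑ i : Fin d, 2 * (N (x + Pi.single i 1) *
              w (x + Pi.single i 1) ^ (2 * (s - 1)) + N x * w x ^ (2 * (s - 1))) := by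
            refine Finset.sum_le_sum fun x _ => Finset.sum_le_sum fun i _ => ?_
            -- The resistance of an edge is bounded by `N` at either endpoint, so each power of `w`
            -- can be paired with `N` at its own site. The sum then reduces to copies of `R`.
            have e1 := h.inv_le _ _ (hunit x i)
            have e2 := h.inv_le _ _ (hunit' x i)
            rw [h.symm] at e2
            have e3 : 0 ≤ (c x (x + Pi.single i 1))⁻¹ := inv_nonneg.2 (h.nonneg _ _)
            rw [← hsq, ← hsq]
            set A := w (x + Pi.single i 1) ^ (s - 1)
            set A' := w x ^ (s - 1)
            have e4 : (A + A') ^ 2 ≤ 2 * (A ^ 2 + A' ^ 2) := by nlinarith [sq_nonneg (A - A')]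
            have e5 := mul_le_mul_of_nonneg_left e4 e3
            have e6 := mul_le_mul_of_nonneg_right e2 (sq_nonneg A)
            have e7 := mul_le_mul_of_nonneg_right e1 (sq_nonneg A')
            linarith
        _ = 2 * ((∑ i : Fin d, ∑ x ∈ Λ, N (x + Pi.single i 1) *
              w (x + Pi.single i 1) ^ (2 * (s - 1))) +
              d * ∑ x ∈ Λ, N x * w x ^ (2 * (s - 1))) := by
            simp_rw [← Finset.mul_sum, Finset.sum_add_distrib]
            rw [Finset.sum_comm]
            simp [Finset.mul_sum]
        _ ≤ 2 * ((∑ i : Fin d, R) + d * R) := by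
            gcongr with i
            · exact sum_shift_le hM0 hMB Λ (Pi.single i 1)
            · simpa using sum_shift_le hM0 hMB Λ 0
        _ = 4 * d * R := by
            simp; ring
    refine hcs.trans (mul_le_mul (h.sum_nearest_le_energy hw hB hnb) hres ?_ (by positivity))
    exact Finset.sum_nonneg fun x _ => Finset.sum_nonneg fun i _ =>
      mul_nonneg (inv_nonneg.2 (h.nonneg _ _)) (sq_nonneg _)
  have h5 : R ≤ Q * X ^ (1 - b) := by
    have hconj : Real.HolderConjugate b⁻¹ (1 - b)⁻¹ := by
      rw [Real.holderConjugate_iff]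
      exact ⟨(one_lt_inv₀ hb).2 hb1, by rw [inv_inv, inv_inv]; ring⟩
    have h6 := Real.inner_le_Lp_mul_Lq_of_nonneg B hconj (f := N)
      (g := fun x => w x ^ (2 * (s - 1))) (fun x _ => h.right_nonneg x)
      (fun x _ => Real.rpow_nonneg (hw0 x) _)
    simp only [one_div, inv_inv] at h6
    refine h6.trans (le_of_eq ?_)
    rw [hQ, hX]
    congr 2
    refine Finset.sum_congr rfl fun x _ => ?_
    rw [← Real.rpow_mul (hw0 x)]
    congr 1
    rw [hs]
    have : 1 - b ≠ 0 := by linarith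
    field_simp
    ring
  rcases hX0.eq_or_lt with hX' | hX'
  · rw [← hX', Real.zero_rpow (inv_pos.2 hρ).ne']
    positivity
  -- The exponents match because `1/ρ + 1 - b = 2(d-1)/d`.
  · have h7 : X ^ ρ⁻¹ * X ^ (1 - b) = (X ^ (((d : ℝ) - 1) / d)) ^ 2 := by
      rw [← Real.rpow_add hX', ← Real.rpow_natCast, ← Real.rpow_mul hX0, hρb]
      congr 1
      push_cast
      field_simp
      ring
    have h8 : X ^ ρ⁻¹ * X ^ (1 - b) ≤ ((2 * d * s) ^ 2 * Q * E) * X ^ (1 - b) := by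
      rw [h7]
      calc (X ^ (((d : ℝ) - 1) / d)) ^ 2 ≤ (s * G) ^ 2 :=
            pow_le_pow_left₀ (Real.rpow_nonneg hX0 _) h1 2
        _ = s ^ 2 * G ^ 2 := by ring
        _ ≤ s ^ 2 * ((d * E) * (4 * d * (Q * X ^ (1 - b)))) := by
            refine mul_le_mul_of_nonneg_left (h4.trans ?_) (sq_nonneg s)
            gcongr
        _ = _ := by ring
    exact le_of_mul_le_mul_right h8 (Real.rpow_pos_of_pos hX' _)

end WeightedSobolev

/-! ### Caccioppoli inequality with long jumps -/

section Energy

variable {d : ℕ} {c : (Fin d → ℤ) → (Fin d → ℤ) → ℝ} {m : ℝ} {W N : (Fin d → ℤ) → ℝ}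

/-- The positive part `(f - k)₊` restricted to `B`. -/
noncomputable def trunc (B : Finset (Fin d → ℤ)) (k : ℝ) (f : (Fin d → ℤ) → ℝ) (x : Fin d → ℤ) : ℝ :=
  if x ∈ B then max (f x - k) 0 else 0

theorem trunc_nonneg (B : Finset (Fin d → ℤ)) (k : ℝ) (f : (Fin d → ℤ) → ℝ) (x : Fin d → ℤ) :
    0 ≤ trunc B k f x := by
  unfold trunc; split_ifs <;> simp

theorem trunc_of_mem {B : Finset (Fin d → ℤ)} {x : Fin d → ℤ} (hx : x ∈ B) (k : ℝ)
    (f : (Fin d → ℤ) → ℝ) : trunc B k f x = max (f x - k) 0 := if_pos hx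

theorem trunc_of_notMem {B : Finset (Fin d → ℤ)} {x : Fin d → ℤ} (hx : x ∉ B) (k : ℝ)
    (f : (Fin d → ℤ) → ℝ) : trunc B k f x = 0 := if_neg hx

/-- Inside `B`, replacing `f` by its truncation only increases the differences from a site where `f
≥ k`. Outside `B` the truncation discards at most `U` per unit of conductance, and there `1 ≤ δ^{-m}
|y - x|^m`, so the `m`-th moment pays for the loss. -/
theorem IsDominated.tsum_le_sum_trunc (h : IsDominated c m W N) {B Λ : Finset (Fin d → ℤ)}
    (hB : B ⊆ Λ) {f : (Fin d → ℤ) → ℝ} {U k δ : ℝ} (hf : ∀ y, |f y| ≤ U) (hk : 0 ≤ k)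
    (hδ : 0 < δ) {x : Fin d → ℤ} (hx : x ∈ B) (hfx : k ≤ f x)
    (hfar : ∀ y ∉ B, δ ≤ enorm2 (y - x)) :
    ∑' y, (f y - f x) * c x y ≤
      ∑ y ∈ Λ, c x y * (trunc B k f y - trunc B k f x) + U * δ ^ (-m) * W x := by
  have hU : 0 ≤ U := (abs_nonneg _).trans (hf x)
  have hm : 0 < m := by linarith [h.two_le]
  have hvx : trunc B k f x = f x - k := by
    rw [trunc_of_mem hx, max_eq_left (by linarith)]
  have hUδ : 0 ≤ U * δ ^ (-m) := mul_nonneg hU (Real.rpow_nonneg hδ.le _)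
  have hs1 : Summable fun y => (f y - f x) * c x y := by
    refine Summable.of_norm_bounded ((h.summable_conductance x).mul_left (2 * U)) fun y => ?_
    rw [Real.norm_eq_abs, abs_mul, abs_of_nonneg (h.nonneg x y)]
    refine mul_le_mul_of_nonneg_right ?_ (h.nonneg x y)
    exact (abs_sub _ _).trans (by linarith [hf x, hf y])
  have hs2 : Summable fun y => if y ∈ Λ then c x y * (trunc B k f y - trunc B k f x) else 0 :=
    summable_of_ne_finset_zero (s := Λ) fun y hy => if_neg hy
  have hs3 := (h.summable x).mul_left (U * δ ^ (-m))
  have hterm : ∀ y, (f y - f x) * c x y ≤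
      (if y ∈ Λ then c x y * (trunc B k f y - trunc B k f x) else 0) +
        U * δ ^ (-m) * (enorm2 (y - x) ^ m * c x y) := by
    intro y
    have hc := h.nonneg x y
    have hnn : 0 ≤ U * δ ^ (-m) * (enorm2 (y - x) ^ m * c x y) :=
      mul_nonneg hUδ (mul_nonneg (Real.rpow_nonneg (enorm2_nonneg _) _) hc)
    by_cases hyB : y ∈ B
    · rw [if_pos (hB hyB), hvx, trunc_of_mem hyB]
      have : f y - f x ≤ max (f y - k) 0 - (f x - k) := by
        linarith [le_max_left (f y - k) 0]
      nlinarith [mul_le_mul_of_nonneg_right this hc]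
    · have h1 : 1 ≤ δ ^ (-m) * enorm2 (y - x) ^ m := by
        rw [Real.rpow_neg hδ.le, ← div_eq_inv_mul, one_le_div (Real.rpow_pos_of_pos hδ m)]
        exact Real.rpow_le_rpow hδ.le (hfar y hyB) hm.le
      have h2 : U * c x y ≤ U * δ ^ (-m) * (enorm2 (y - x) ^ m * c x y) := by
        have := mul_le_mul_of_nonneg_left h1 (mul_nonneg hU hc)
        linarith
      have h3 : (f y - f x) * c x y ≤ (U - (f x - k)) * c x y :=
        mul_le_mul_of_nonneg_right (by linarith [(abs_le.1 (hf y)).2]) hc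
      have h4 : 0 ≤ (f x - k) * c x y := mul_nonneg (by linarith) hc
      by_cases hyΛ : y ∈ Λ
      · rw [if_pos hyΛ, hvx, trunc_of_notMem hyB]
        linarith
      · rw [if_neg hyΛ]
        linarith
  refine (hs1.tsum_le_tsum hterm (hs2.add hs3)).trans ?_
  rw [hs2.tsum_add hs3, tsum_mul_left,
    tsum_eq_sum (s := Λ) (fun y hy => if_neg hy)]
  refine add_le_add (le_of_eq (Finset.sum_congr rfl fun y hy => if_pos hy)) ?_
  exact mul_le_mul_of_nonneg_left (h.tsum_le x) hUδ

/-- Caccioppoli's identity for a symmetric conductance and a cutoff `φ`. -/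
theorem IsDominated.two_mul_sum_cutoff (h : IsDominated c m W N) (Λ : Finset (Fin d → ℤ))
    (φ v : (Fin d → ℤ) → ℝ) :
    2 * ∑ x ∈ Λ, φ x ^ 2 * v x * ∑ y ∈ Λ, c x y * (v y - v x) =
      -energy c Λ (fun x => φ x * v x) +
        ∑ x ∈ Λ, ∑ y ∈ Λ, c x y * (v x * v y * (φ x - φ y) ^ 2) := by
  have h1 : ∑ x ∈ Λ, φ x ^ 2 * v x * ∑ y ∈ Λ, c x y * (v y - v x) =
      ∑ x ∈ Λ, ∑ y ∈ Λ, φ x ^ 2 * v x * (c x y * (v y - v x)) := by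
    simp_rw [Finset.mul_sum]
  -- Averaging the double sum with its copy under `x ↔ y` makes the claim an identity for each pair.
  -- It yields the energy of `φ v` exactly, so no part of the energy has to be absorbed later.
  have h2 : ∑ x ∈ Λ, φ x ^ 2 * v x * ∑ y ∈ Λ, c x y * (v y - v x) =
      ∑ x ∈ Λ, ∑ y ∈ Λ, φ y ^ 2 * v y * (c x y * (v x - v y)) := by
    rw [h1, Finset.sum_comm]
    refine Finset.sum_congr rfl fun x _ => Finset.sum_congr rfl fun y _ => ?_
    rw [h.symm]
  rw [two_mul]
  nth_rewrite 1 [h1]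
  rw [h2]
  simp only [energy, ← Finset.sum_add_distrib, ← Finset.sum_neg_distrib]
  refine Finset.sum_congr rfl fun x _ => Finset.sum_congr rfl fun y _ => ?_
  ring

/-- By `2 v x v y ≤ v x² + v y²` and symmetry one may replace the product by `v x²`. The Lipschitz
bound on `φ` then leaves a second moment, which is at most `W x`. -/
theorem IsDominated.sum_cutoff_error_le (h : IsDominated c m W N) (Λ : Finset (Fin d → ℤ))
    {φ v : (Fin d → ℤ) → ℝ} {δ : ℝ} (hφ : ∀ x y, |φ x - φ y| ≤ enorm2 (y - x) / δ) :
    ∑ x ∈ Λ, ∑ y ∈ Λ, c x y * (v x * v y * (φ x - φ y) ^ 2) ≤ δ⁻¹ ^ 2 * ∑ x ∈ Λ, W x * v x ^ 2 := by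
  have h0 : ∑ x ∈ Λ, ∑ y ∈ Λ, c x y * (v x ^ 2 * (φ x - φ y) ^ 2) =
      ∑ x ∈ Λ, ∑ y ∈ Λ, c x y * (v y ^ 2 * (φ x - φ y) ^ 2) := by
    rw [Finset.sum_comm]
    refine Finset.sum_congr rfl fun x _ => Finset.sum_congr rfl fun y _ => ?_
    rw [h.symm]; ring
  have h1 : ∑ x ∈ Λ, ∑ y ∈ Λ, c x y * (v x * v y * (φ x - φ y) ^ 2) ≤
      ∑ x ∈ Λ, ∑ y ∈ Λ, c x y * (v x ^ 2 * (φ x - φ y) ^ 2) := by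
    have h2 : 2 * ∑ x ∈ Λ, ∑ y ∈ Λ, c x y * (v x * v y * (φ x - φ y) ^ 2) ≤
        ∑ x ∈ Λ, ∑ y ∈ Λ, c x y * (v x ^ 2 * (φ x - φ y) ^ 2) +
        ∑ x ∈ Λ, ∑ y ∈ Λ, c x y * (v y ^ 2 * (φ x - φ y) ^ 2) := by
      simp only [Finset.mul_sum, ← Finset.sum_add_distrib]
      refine Finset.sum_le_sum fun x _ => Finset.sum_le_sum fun y _ => ?_
      have := mul_nonneg (h.nonneg x y)
        (mul_nonneg (sq_nonneg (v x - v y)) (sq_nonneg (φ x - φ y)))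
      linarith
    linarith
  refine h1.trans ?_
  rw [Finset.mul_sum]
  refine Finset.sum_le_sum fun x _ => ?_
  calc ∑ y ∈ Λ, c x y * (v x ^ 2 * (φ x - φ y) ^ 2)
      ≤ ∑ y ∈ Λ, δ⁻¹ ^ 2 * v x ^ 2 * (enorm2 (y - x) ^ 2 * c x y) := by
        refine Finset.sum_le_sum fun y _ => ?_
        have h3 : (φ x - φ y) ^ 2 ≤ (enorm2 (y - x) / δ) ^ 2 := by
          rw [← sq_abs]
          exact pow_le_pow_left₀ (abs_nonneg _) (hφ x y) 2
        calc c x y * (v x ^ 2 * (φ x - φ y) ^ 2)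
            ≤ c x y * (v x ^ 2 * (enorm2 (y - x) / δ) ^ 2) :=
              mul_le_mul_of_nonneg_left (mul_le_mul_of_nonneg_left h3 (sq_nonneg _)) (h.nonneg _ _)
          _ = _ := by ring
    _ = δ⁻¹ ^ 2 * v x ^ 2 * ∑ y ∈ Λ, enorm2 (y - x) ^ 2 * c x y := by rw [Finset.mul_sum]
    _ ≤ δ⁻¹ ^ 2 * v x ^ 2 * W x := mul_le_mul_of_nonneg_left (h.sum_sq_le x Λ) (by positivity)
    _ = _ := by ring

/-- This is the spatial half of the energy estimate, from testing the generator with `φ² (f - k)₊`.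
The quadratic error comes from the cutoff. The linear one comes from the far jumps and is turned
into a quadratic one later, at the price of raising the level. -/
theorem IsDominated.caccioppoli (h : IsDominated c m W N) {B Λ : Finset (Fin d → ℤ)}
    (hB : B ⊆ Λ) {f φ : (Fin d → ℤ) → ℝ} {U k δ : ℝ} (hf : ∀ y, |f y| ≤ U) (hk : 0 ≤ k)
    (hδ : 0 < δ) (hφ : ∀ x y, |φ x - φ y| ≤ enorm2 (y - x) / δ) (hφ1 : ∀ x, φ x ^ 2 ≤ 1)
    (hfar : ∀ x, φ x ≠ 0 → ∀ y ∉ B, δ ≤ enorm2 (y - x)) :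
    ∑ x ∈ B, φ x ^ 2 * (2 * max (f x - k) 0 * ∑' y, (f y - f x) * c x y) ≤
      (δ⁻¹ ^ 2 * ∑ x ∈ B, W x * max (f x - k) 0 ^ 2 +
        2 * U * δ ^ (-m) * ∑ x ∈ B, W x * max (f x - k) 0) -
      energy c Λ (fun x => φ x * trunc B k f x) := by
  set v := trunc B k f with hv
  have hv0 : ∀ x, 0 ≤ v x := trunc_nonneg B k f
  have hU : 0 ≤ U := (abs_nonneg _).trans (hf 0)
  have hUδ : 0 ≤ U * δ ^ (-m) := mul_nonneg hU (Real.rpow_nonneg hδ.le _)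
  -- All sums involved vanish where the truncation does, so they may run over `Λ`, where the double
  -- sums are symmetric.
  have hext : ∀ g : (Fin d → ℤ) → ℝ → ℝ, (∀ x, g x 0 = 0) →
      ∑ x ∈ Λ, g x (v x) = ∑ x ∈ B, g x (max (f x - k) 0) := by
    intro g hg
    rw [← Finset.sum_subset hB fun x _ hx => by rw [hv, trunc_of_notMem hx, hg]]
    exact Finset.sum_congr rfl fun x hx => by rw [hv, trunc_of_mem hx]
  rw [← hext (fun x s => φ x ^ 2 * (2 * s * ∑' y, (f y - f x) * c x y)) (by simp),
    ← hext (fun x s => W x * s ^ 2) (by simp), ← hext (fun x s => W x * s) (by simp)]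
  have hpt : ∀ x ∈ Λ, φ x ^ 2 * (2 * v x * ∑' y, (f y - f x) * c x y) ≤
      2 * (φ x ^ 2 * v x * ∑ y ∈ Λ, c x y * (v y - v x)) + 2 * U * δ ^ (-m) * (W x * v x) := by
    intro x _
    have hnn : 0 ≤ 2 * U * δ ^ (-m) * (W x * v x) := by
      have := mul_nonneg hUδ (mul_nonneg (h.left_nonneg x) (hv0 x))
      linarith
    rcases (hv0 x).eq_or_lt with hvx | hvx
    · rw [← hvx]; simp
    by_cases hφx : φ x = 0
    · rw [hφx]; simpa using hnn
    have hxB : x ∈ B := by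
      by_contra hx
      rw [hv, trunc_of_notMem hx] at hvx
      exact hvx.false
    have hfx : k ≤ f x := by
      by_contra hlt
      rw [hv, trunc_of_mem hxB, max_eq_right (by linarith)] at hvx
      exact hvx.false
    have h1 := h.tsum_le_sum_trunc hB hf hk hδ hxB hfx (hfar x hφx)
    have h2 : 0 ≤ 2 * (φ x ^ 2 * v x) := by positivity
    have h3 := mul_le_mul_of_nonneg_left h1 h2
    have h4 : φ x ^ 2 * (2 * v x * (U * δ ^ (-m) * W x)) ≤ 1 * (2 * v x * (U * δ ^ (-m) * W x)) :=
      mul_le_mul_of_nonneg_right (hφ1 x)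
        (mul_nonneg (by linarith) (mul_nonneg hUδ (h.left_nonneg x)))
    linarith
  refine (Finset.sum_le_sum hpt).trans ?_
  rw [Finset.sum_add_distrib, ← Finset.mul_sum, ← Finset.mul_sum, h.two_mul_sum_cutoff]
  have := h.sum_cutoff_error_le Λ (v := v) hφ
  linarith

end Energy

/-! ### Radial cutoff functions -/

section Cutoff

/-- The radial cutoff equal to `1` on `B_r` and vanishing outside `B_{r + δ}`. -/
noncomputable def cutoff {d : ℕ} (r δ : ℝ) (x : Fin d → ℤ) : ℝ := max 0 (min 1 ((r + δ - enorm2 x) / δ))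

variable {d : ℕ} {r δ : ℝ}

theorem cutoff_nonneg (x : Fin d → ℤ) : 0 ≤ cutoff r δ x := le_max_left _ _

theorem cutoff_sq_le_one (x : Fin d → ℤ) : cutoff r δ x ^ 2 ≤ 1 :=
  pow_le_one₀ (cutoff_nonneg x) (max_le zero_le_one (min_le_left _ _))

theorem cutoff_eq_one (hδ : 0 < δ) {x : Fin d → ℤ} (hx : x ∈ ball d r) : cutoff r δ x = 1 := by
  have : 1 ≤ (r + δ - enorm2 x) / δ := by
    rw [one_le_div hδ]; linarith [mem_ball.1 hx]
  rw [cutoff, min_eq_left this, max_eq_right zero_le_one]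

theorem enorm2_le_of_cutoff_ne_zero (hδ : 0 < δ) {x : Fin d → ℤ} (hx : cutoff r δ x ≠ 0) :
    enorm2 x ≤ r + δ := by
  by_contra hlt
  refine hx (max_eq_left ((min_le_right _ _).trans ?_))
  exact div_nonpos_of_nonpos_of_nonneg (by linarith) hδ.le

theorem abs_cutoff_sub_le (hδ : 0 < δ) (x y : Fin d → ℤ) :
    |cutoff r δ x - cutoff r δ y| ≤ enorm2 (y - x) / δ := by
  unfold cutoff
  refine (abs_max_sub_max_le_max _ _ _ _).trans ?_
  rw [sub_self, abs_zero]
  refine max_le (div_nonneg (enorm2_nonneg _) hδ.le) ?_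
  refine (abs_min_sub_min_le_max _ _ _ _).trans ?_
  rw [sub_self, abs_zero]
  refine max_le (div_nonneg (enorm2_nonneg _) hδ.le) ?_
  rw [← sub_div, abs_div, abs_of_pos hδ]
  refine div_le_div_of_nonneg_right ?_ hδ.le
  rw [sub_sub_sub_cancel_left, abs_sub_comm]
  exact abs_enorm2_sub_le x y

end Cutoff

/-! ### Energy estimate in time -/

section TimeEnergy

/-- Energy estimate in time: if `F' ≤ G - E` on `[T₀, 0]` then both `F` and the integral of `E`
are controlled, from time `T₁` on, by the integral of `F + |T₀| G`. -/
theorem energy_estimate {F F' E G : ℝ → ℝ} {T₀ T₁ : ℝ} (h01 : T₀ < T₁) (h1 : T₁ ≤ 0)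
    (hF : ContinuousOn F (Icc T₀ 0)) (hE : ContinuousOn E (Icc T₀ 0))
    (hG : ContinuousOn G (Icc T₀ 0))
    (hderiv : ∀ t ∈ Ioo T₀ 0, HasDerivAt F (F' t) t) (hle : ∀ t ∈ Ioo T₀ 0, F' t ≤ G t - E t)
    (hF0 : ∀ t ∈ Icc T₀ 0, 0 ≤ F t) (hE0 : ∀ t ∈ Icc T₀ 0, 0 ≤ E t)
    (hG0 : ∀ t ∈ Icc T₀ 0, 0 ≤ G t) :
    (∀ t ∈ Icc T₁ 0, (T₁ - T₀) * F t ≤ ∫ s in T₀..0, F s + |T₀| * G s) ∧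
      (T₁ - T₀) * ∫ s in T₁..0, E s ≤ ∫ s in T₀..0, F s + |T₀| * G s := by
  have hT0 : T₀ < 0 := h01.trans_le h1
  -- Integrate the derivative of `(s - T₀) F s`. The linear weight acts as a time cutoff: it
  -- vanishes at `T₀`, which removes the initial value, and is at least `T₁ - T₀` from `T₁` on.
  have main : ∀ t ∈ Icc T₁ 0, (t - T₀) * F t + (T₁ - T₀) * ∫ s in T₁..t, E s ≤
      ∫ s in T₀..0, F s + |T₀| * G s := by
    intro t ht
    have htT : T₀ ≤ t := h01.le.trans ht.1
    have hsub : Icc T₀ t ⊆ Icc T₀ 0 := Icc_subset_Icc le_rfl ht.2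
    have hcE : ContinuousOn (fun s => (s - T₀) * E s) (Icc T₀ 0) :=
      (continuousOn_id.sub continuousOn_const).mul hE
    have hcG : ContinuousOn (fun s => F s + (s - T₀) * G s) (Icc T₀ 0) :=
      hF.add ((continuousOn_id.sub continuousOn_const).mul hG)
    have hcR : ContinuousOn (fun s => F s + |T₀| * G s) (Icc T₀ 0) :=
      hF.add (continuousOn_const.mul hG)
    have key := intervalIntegral.sub_le_integral_of_hasDeriv_right_of_le (g := fun s => (s - T₀) * F s)
      (g' := fun s => 1 * F s + (s - T₀) * F' s)
      (φ := fun s => (F s + (s - T₀) * G s) - (s - T₀) * E s) htT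
      (((continuousOn_id.sub continuousOn_const).mul hF).mono hsub)
      (fun s hs => (((hasDerivAt_id s).sub_const T₀).mul
        (hderiv s ⟨hs.1, hs.2.trans_le ht.2⟩)).hasDerivWithinAt)
      ((hcG.sub hcE).mono hsub |>.integrableOn_Icc)
      (fun s hs => by
        have := mul_le_mul_of_nonneg_left (hle s ⟨hs.1, hs.2.trans_le ht.2⟩)
          (sub_nonneg.2 hs.1.le)
        linarith)
    have hiG : IntervalIntegrable (fun s => F s + (s - T₀) * G s) volume T₀ t :=
      (hcG.mono hsub).intervalIntegrable_of_Icc htT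
    have hiE : IntervalIntegrable (fun s => (s - T₀) * E s) volume T₀ t :=
      (hcE.mono hsub).intervalIntegrable_of_Icc htT
    rw [intervalIntegral.integral_sub hiG hiE] at key
    have hsub1 : Icc T₁ t ⊆ Icc T₀ 0 := Icc_subset_Icc h01.le ht.2
    have e1 : (T₁ - T₀) * ∫ s in T₁..t, E s ≤ ∫ s in T₀..t, (s - T₀) * E s := by
      rw [← intervalIntegral.integral_const_mul]
      calc ∫ s in T₁..t, (T₁ - T₀) * E s ≤ ∫ s in T₁..t, (s - T₀) * E s := by
            refine intervalIntegral.integral_mono_on ht.1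
              ((continuousOn_const.mul hE).mono hsub1 |>.intervalIntegrable_of_Icc ht.1)
              ((hcE.mono hsub1).intervalIntegrable_of_Icc ht.1) fun s hs => ?_
            exact mul_le_mul_of_nonneg_right (by linarith [hs.1]) (hE0 s (hsub1 hs))
        _ ≤ ∫ s in T₀..t, (s - T₀) * E s := by
            refine intervalIntegral.integral_mono_interval h01.le ht.1 le_rfl ?_ hiE
            refine (ae_restrict_iff' measurableSet_Ioc).2 (Filter.Eventually.of_forall fun s hs => ?_)
            exact mul_nonneg (by linarith [hs.1]) (hE0 s ⟨hs.1.le, hs.2.trans ht.2⟩)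
    have e2 : ∫ s in T₀..t, F s + (s - T₀) * G s ≤ ∫ s in T₀..0, F s + |T₀| * G s := by
      calc ∫ s in T₀..t, F s + (s - T₀) * G s ≤ ∫ s in T₀..t, F s + |T₀| * G s := by
            refine intervalIntegral.integral_mono_on htT hiG
              ((hcR.mono hsub).intervalIntegrable_of_Icc htT) fun s hs => ?_
            rw [abs_of_neg hT0]
            have := mul_le_mul_of_nonneg_right (show s - T₀ ≤ -T₀ by linarith [hs.2, ht.2])
              (hG0 s (hsub hs))
            linarith
        _ ≤ ∫ s in T₀..0, F s + |T₀| * G s := by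
            refine intervalIntegral.integral_mono_interval le_rfl htT ht.2 ?_
              (hcR.intervalIntegrable_of_Icc hT0.le)
            refine (ae_restrict_iff' measurableSet_Ioc).2 (Filter.Eventually.of_forall fun s hs => ?_)
            exact add_nonneg (hF0 s ⟨hs.1.le, hs.2⟩)
              (mul_nonneg (abs_nonneg _) (hG0 s ⟨hs.1.le, hs.2⟩))
    simp only [sub_self, zero_mul, sub_zero] at key
    linarith
  constructor
  · intro t ht
    have h2 := main t ht
    have h3 : 0 ≤ ∫ s in T₁..t, E s :=
      intervalIntegral.integral_nonneg ht.1 fun s hs => hE0 s ⟨h01.le.trans hs.1, hs.2.trans ht.2⟩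
    have h4 := mul_nonneg (sub_nonneg.2 h01.le) h3
    have h5 := mul_le_mul_of_nonneg_right (show T₁ - T₀ ≤ t - T₀ by linarith [ht.1])
      (hF0 t ⟨h01.le.trans ht.1, ht.2⟩)
    linarith
  · have h2 := main 0 ⟨h1, le_rfl⟩
    have h3 := mul_nonneg (show 0 ≤ 0 - T₀ by linarith) (hF0 0 ⟨hT0.le, le_rfl⟩)
    linarith

end TimeEnergy

/-! ### Hölder inequalities and the squared positive part -/

section Holder

theorem sum_rpow_mul_rpow_le {ι : Type*} (s : Finset ι) {f g : ι → ℝ} {a : ℝ} (ha : 0 < a)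
    (ha1 : a < 1) (hf : ∀ i ∈ s, 0 ≤ f i) (hg : ∀ i ∈ s, 0 ≤ g i) :
    ∑ i ∈ s, f i ^ a * g i ^ (1 - a) ≤ (∑ i ∈ s, f i) ^ a * (∑ i ∈ s, g i) ^ (1 - a) := by
  have hconj : Real.HolderConjugate a⁻¹ (1 - a)⁻¹ := by
    rw [Real.holderConjugate_iff]
    exact ⟨(one_lt_inv₀ ha).2 ha1, by rw [inv_inv, inv_inv]; ring⟩
  have h := Real.inner_le_Lp_mul_Lq_of_nonneg s hconj (f := fun i => f i ^ a)
    (g := fun i => g i ^ (1 - a)) (fun i hi => Real.rpow_nonneg (hf i hi) _)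
    (fun i hi => Real.rpow_nonneg (hg i hi) _)
  simp only [one_div, inv_inv] at h
  refine h.trans (le_of_eq ?_)
  congr 2
  · exact Finset.sum_congr rfl fun i hi => Real.rpow_rpow_inv (hf i hi) ha.ne'
  · exact Finset.sum_congr rfl fun i hi => Real.rpow_rpow_inv (hg i hi) (by linarith)

theorem sum_rpow_mul_rpow_mul_rpow_le {ι : Type*} (s : Finset ι) {f g h : ι → ℝ} {a b e : ℝ}
    (ha : 0 < a) (hb : 0 < b) (he : 0 < e) (habe : a + b + e = 1) (hf : ∀ i ∈ s, 0 ≤ f i)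
    (hg : ∀ i ∈ s, 0 ≤ g i) (hh : ∀ i ∈ s, 0 ≤ h i) :
    ∑ i ∈ s, f i ^ a * (g i ^ b * h i ^ e) ≤
      (∑ i ∈ s, f i) ^ a * ((∑ i ∈ s, g i) ^ b * (∑ i ∈ s, h i) ^ e) := by
  have h1 : 0 < 1 - a := by linarith
  have hθ1 : b / (1 - a) < 1 := by rw [div_lt_one h1]; linarith
  have hθ : 1 - b / (1 - a) = e / (1 - a) := by field_simp; linarith
  have split : ∀ x y : ℝ, 0 ≤ x → 0 ≤ y →
      (x ^ (b / (1 - a)) * y ^ (1 - b / (1 - a))) ^ (1 - a) = x ^ b * y ^ e := by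
    intro x y hx hy
    rw [Real.mul_rpow (Real.rpow_nonneg hx _) (Real.rpow_nonneg hy _), ← Real.rpow_mul hx,
      ← Real.rpow_mul hy, hθ, div_mul_cancel₀ _ h1.ne', div_mul_cancel₀ _ h1.ne']
  have hf' := Finset.sum_nonneg hf
  have hg' := Finset.sum_nonneg hg
  have hh' := Finset.sum_nonneg hh
  have hnn : ∀ i ∈ s, 0 ≤ g i ^ (b / (1 - a)) * h i ^ (1 - b / (1 - a)) := fun i hi =>
    mul_nonneg (Real.rpow_nonneg (hg i hi) _) (Real.rpow_nonneg (hh i hi) _)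
  calc _ = ∑ i ∈ s, f i ^ a * (g i ^ (b / (1 - a)) * h i ^ (1 - b / (1 - a))) ^ (1 - a) :=
        Finset.sum_congr rfl fun i hi => by rw [split _ _ (hg i hi) (hh i hi)]
    _ ≤ (∑ i ∈ s, f i) ^ a *
        (∑ i ∈ s, g i ^ (b / (1 - a)) * h i ^ (1 - b / (1 - a))) ^ (1 - a) :=
        sum_rpow_mul_rpow_le s ha (by linarith) hf hnn
    _ ≤ (∑ i ∈ s, f i) ^ a *
        ((∑ i ∈ s, g i) ^ (b / (1 - a)) * (∑ i ∈ s, h i) ^ (1 - b / (1 - a))) ^ (1 - a) := by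
        refine mul_le_mul_of_nonneg_left (Real.rpow_le_rpow (Finset.sum_nonneg hnn) ?_ h1.le)
          (Real.rpow_nonneg hf' _)
        exact sum_rpow_mul_rpow_le s (div_pos hb h1) hθ1 hg hh
    _ = _ := by rw [split _ _ hg' hh']

end Holder

/-- The squared positive part is differentiable even at its kink, as its first-order remainder is at
most `|x - s|²` everywhere. -/
theorem hasDerivAt_max_zero_sq (s : ℝ) :
    HasDerivAt (fun s : ℝ => max s 0 ^ 2) (2 * max s 0) s := by
  rw [hasDerivAt_iff_isLittleO]
  refine Asymptotics.IsBigO.trans_isLittleO (g := fun x => ‖x - s‖ ^ 2) ?_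
    (Asymptotics.isLittleO_pow_sub_sub s one_lt_two)
  refine Asymptotics.IsBigO.of_bound 1 (Filter.Eventually.of_forall fun x => ?_)
  rw [one_mul, norm_pow, norm_norm, Real.norm_eq_abs, Real.norm_eq_abs, sq_abs, smul_eq_mul, abs_le]
  rcases le_total x 0 with hx | hx <;> rcases le_total s 0 with hs | hs <;>
    simp only [max_eq_left, max_eq_right, hx, hs] <;> constructor <;> nlinarith

/-! ### One De Giorgi step -/

section Step

variable {d : ℕ} {c : (Fin d → ℤ) → (Fin d → ℤ) → ℝ} {m : ℝ} {W N : (Fin d → ℤ) → ℝ}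

/-- `u` solves the heat equation for `c` on `(-n²,0] × B_n` and `|u| ≤ U` on `(-n²,0] × ℤ^d`. -/
structure IsBoundedCaloric (c : (Fin d → ℤ) → (Fin d → ℤ) → ℝ) (n : ℕ) (U : ℝ)
    (u : ℝ → (Fin d → ℤ) → ℝ) : Prop where
  one_le : 1 ≤ n
  bound : ∀ t ∈ Ioc (-(n : ℝ) ^ 2) 0, ∀ y, |u t y| ≤ U
  deriv : ∀ t ∈ Ioo (-(n : ℝ) ^ 2) 0, ∀ x ∈ ball d n,
    HasDerivAt (fun r => u r x) (∑' y, (u t y - u t x) * c x y) t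
  cont : ∀ x ∈ ball d n, ContinuousOn (fun t => u t x) (Ioc (-(n : ℝ) ^ 2) 0)

theorem IsBoundedCaloric.neg {n : ℕ} {U : ℝ} {u : ℝ → (Fin d → ℤ) → ℝ}
    (hu : IsBoundedCaloric c n U u) : IsBoundedCaloric c n U fun t x => -u t x where
  one_le := hu.one_le
  bound t ht y := by rw [abs_neg]; exact hu.bound t ht y
  deriv t ht x hx := by
    refine (hu.deriv t ht x hx).fun_neg.congr_deriv ?_
    rw [← tsum_neg]
    exact tsum_congr fun y => by ring
  cont x hx := (hu.cont x hx).neg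

/-- The weighted space-time mass of `(u - k)₊²` over `[T,0] × B_r`. -/
noncomputable def mass (W : (Fin d → ℤ) → ℝ) (u : ℝ → (Fin d → ℤ) → ℝ) (k r T : ℝ) : ℝ :=
  ∫ t in T..0, ∑ x ∈ ball d r, W x * max (u t x - k) 0 ^ 2

theorem IsBoundedCaloric.continuousOn_mass_integrand {n : ℕ} {U : ℝ} {u : ℝ → (Fin d → ℤ) → ℝ}
    (hu : IsBoundedCaloric c n U u) {r T : ℝ} (k : ℝ) (hr : r ≤ n) (hT : -(n : ℝ) ^ 2 < T) :
    ContinuousOn (fun t => ∑ x ∈ ball d r, W x * max (u t x - k) 0 ^ 2) (Icc T 0) := by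
  refine continuousOn_finsetSum _ fun x hx => continuousOn_const.mul (ContinuousOn.pow ?_ 2)
  exact (((hu.cont x (ball_mono hr hx)).mono fun t ht => ⟨hT.trans_le ht.1, ht.2⟩).sub
    continuousOn_const).sup continuousOn_const

/-- Hölder's inequality with exponents `a`, `1/ρ`, `ε` for the functions `W^{1/a}`, `w^{2ρ}`, `w²`;
the middle factor is controlled by `weighted_sobolev`. The surplus `ε` is what makes the recursion
superlinear. -/
theorem IsDominated.sum_weight_rpow_le (h : IsDominated c m W N) (hd : 2 ≤ d) {a b ρ ε : ℝ}
    (ha : 0 < a) (hb : 0 < b) (hb1 : b < 1) (hρ : 0 < ρ) (hρb : ρ⁻¹ = 1 - 2 / d + b)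
    (hε : 0 < ε) (hsum : a + ρ⁻¹ + ε = 1)
    {B Λ : Finset (Fin d → ℤ)} {w : (Fin d → ℤ) → ℝ} (hw0 : ∀ x, 0 ≤ w x)
    (hw : ∀ x ∉ B, w x = 0) (hB : B ⊆ Λ)
    (hnb : ∀ x ∈ B, ∀ i, x + Pi.single i 1 ∈ Λ) (hnb' : ∀ x ∈ B, ∀ i, x - Pi.single i 1 ∈ Λ) :
    ∑ x ∈ B, W x * w x ^ (2 + 2 * ε) ≤
      (2 * d * (1 + ρ * (1 - b))) ^ 2 * (∑ x ∈ B, W x ^ a⁻¹) ^ a * (∑ x ∈ B, N x ^ b⁻¹) ^ b *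
        energy c Λ w * (∑ x ∈ B, w x ^ 2) ^ ε := by
  have h1 := sum_rpow_mul_rpow_mul_rpow_le B ha (inv_pos.2 hρ) hε hsum
    (f := fun x => W x ^ a⁻¹) (g := fun x => w x ^ (2 * ρ)) (h := fun x => w x ^ 2)
    (fun x _ => Real.rpow_nonneg (h.left_nonneg x) _) (fun x _ => Real.rpow_nonneg (hw0 x) _)
    (fun x _ => sq_nonneg _)
  have h2 : ∀ x, (W x ^ a⁻¹) ^ a * ((w x ^ (2 * ρ)) ^ ρ⁻¹ * (w x ^ 2) ^ ε) =
      W x * w x ^ (2 + 2 * ε) := by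
    intro x
    rw [Real.rpow_inv_rpow (h.left_nonneg x) ha.ne', ← Real.rpow_mul (hw0 x),
      mul_inv_cancel_right₀ hρ.ne', ← Real.rpow_natCast, ← Real.rpow_mul (hw0 x),
      ← Real.rpow_add_of_nonneg (hw0 x) (by norm_num) (by positivity)]
    norm_num
  simp_rw [h2] at h1
  refine h1.trans ?_
  have h3 := h.weighted_sobolev hd hb hb1 hρ hρb hw0 hw hB hnb hnb'
  have hP : 0 ≤ (∑ x ∈ B, W x ^ a⁻¹) ^ a := Real.rpow_nonneg
    (Finset.sum_nonneg fun x _ => Real.rpow_nonneg (h.left_nonneg x) _) _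
  have hS : 0 ≤ (∑ x ∈ B, w x ^ 2) ^ ε := Real.rpow_nonneg
    (Finset.sum_nonneg fun x _ => sq_nonneg _) _
  have h4 := mul_le_mul_of_nonneg_left (mul_le_mul_of_nonneg_right h3 hS) hP
  linarith

/-- Both the supremum in time of the `L²` norm and the integrated energy are bounded by the same
multiple `A` of the old mass. The gain of integrability uses the first to the power `ε` and the
second once, hence `A^{1+ε}`. Radius and level each move by two increments. In space, one `δ` is for
the cutoff and one keeps its support away from the complement of the ball; in level, one `g`
linearises the tail and one lowers the power from `2 + 2ε` to 2. -/
theorem IsDominated.mass_step (h : IsDominated c m W N) (hd : 2 ≤ d) {a b ρ ε : ℝ}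
    (ha : 0 < a) (hb : 0 < b) (hb1 : b < 1) (hρ : 0 < ρ) (hρb : ρ⁻¹ = 1 - 2 / d + b)
    (hε : 0 < ε) (hsum : a + ρ⁻¹ + ε = 1) {n : ℕ} {U : ℝ} {u : ℝ → (Fin d → ℤ) → ℝ}
    (hu : IsBoundedCaloric c n U u) {k g r₀ r₁ T₀ T₁ δ : ℝ} (hk : 0 ≤ k) (hg : 0 < g)
    (hδ : 0 < δ) (hr : r₁ + 2 * δ ≤ r₀) (hr₀ : r₀ ≤ n) (hT₀ : -(n : ℝ) ^ 2 < T₀) (hT : T₀ < T₁)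
    (hT₁ : T₁ ≤ 0) :
    mass W u (k + 2 * g) r₁ T₁ ≤
      (g⁻¹) ^ (2 * ε) * ((2 * d * (1 + ρ * (1 - b))) ^ 2 * (∑ x ∈ ball d r₀, W x ^ a⁻¹) ^ a *
        (∑ x ∈ ball d r₀, N x ^ b⁻¹) ^ b) *
        ((T₁ - T₀)⁻¹ * ((1 + (n : ℝ) ^ 2 * (δ⁻¹ ^ 2 + 2 * U * δ ^ (-m) * g⁻¹)) *
          mass W u k r₀ T₀)) ^ (1 + ε) := by
  set B := ball d r₀ with hBdef
  set Λ := ball d (2 * n) with hΛ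
  set φ : (Fin d → ℤ) → ℝ := cutoff r₁ δ with hφ
  have hn1 : (1 : ℝ) ≤ n := by exact_mod_cast hu.one_le
  have hBn : B ⊆ ball d n := ball_mono hr₀
  have hBΛ : B ⊆ Λ := ball_mono (by linarith)
  have hnb : ∀ x ∈ B, ∀ i, x + Pi.single i 1 ∈ Λ := fun x hx i => mem_ball.2 <| by
    have := enorm2_add_le x (Pi.single i 1)
    rw [enorm2_single] at this
    linarith [mem_ball.1 hx]
  have hnb' : ∀ x ∈ B, ∀ i, x - Pi.single i 1 ∈ Λ := fun x hx i => mem_ball.2 <| by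
    have := enorm2_add_le x (-Pi.single i 1)
    rw [enorm2_neg, enorm2_single, ← sub_eq_add_neg] at this
    linarith [mem_ball.1 hx]
  have hfar : ∀ x, φ x ≠ 0 → ∀ y ∉ B, δ ≤ enorm2 (y - x) := by
    intro x hx y hy
    have h1 := enorm2_le_of_cutoff_ne_zero hδ hx
    have h2 : r₀ < enorm2 y := not_le.1 fun h => hy (mem_ball.2 h)
    have h3 := enorm2_add_le (y - x) x
    rw [sub_add_cancel] at h3
    linarith
  have hT₀0 : T₀ < 0 := hT.trans_le hT₁
  have hIcc : ∀ t ∈ Icc T₀ 0, t ∈ Ioc (-(n : ℝ) ^ 2) 0 := fun t ht => ⟨hT₀.trans_le ht.1, ht.2⟩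
  have hU : 0 ≤ U := (abs_nonneg _).trans (hu.bound 0 (hIcc 0 ⟨hT₀0.le, le_rfl⟩) 0)
  have hUδ : 0 ≤ 2 * U * δ ^ (-m) := mul_nonneg (by linarith) (Real.rpow_nonneg hδ.le _)
  set k' := k + g with hk'
  set F : ℝ → ℝ := fun t => ∑ x ∈ B, φ x ^ 2 * max (u t x - k') 0 ^ 2 with hF
  set F' : ℝ → ℝ := fun t => ∑ x ∈ B, φ x ^ 2 *
    (2 * max (u t x - k') 0 * ∑' y, (u t y - u t x) * c x y) with hF'
  set G : ℝ → ℝ := fun t => δ⁻¹ ^ 2 * ∑ x ∈ B, W x * max (u t x - k') 0 ^ 2 +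
        2 * U * δ ^ (-m) * ∑ x ∈ B, W x * max (u t x - k') 0 with hG
  set w : ℝ → (Fin d → ℤ) → ℝ := fun t x => φ x * trunc B k' (u t) x with hw
  have hw0 : ∀ t x, 0 ≤ w t x := fun t x => mul_nonneg (cutoff_nonneg x) (trunc_nonneg _ _ _ _)
  have hwB : ∀ t, ∀ x ∉ B, w t x = 0 := fun t x hx => by simp [hw, trunc_of_notMem hx]
  set E : ℝ → ℝ := fun t => energy c Λ (w t) with hE
  have hcv : ∀ x ∈ B, ContinuousOn (fun t => max (u t x - k') 0) (Icc T₀ 0) := fun x hx =>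
    (((hu.cont x (hBn hx)).mono hIcc).sub continuousOn_const).sup continuousOn_const
  have hcw : ∀ x, ContinuousOn (fun t => w t x) (Icc T₀ 0) := by
    intro x
    by_cases hx : x ∈ B
    · simp only [hw, trunc_of_mem hx]
      exact continuousOn_const.mul (hcv x hx)
    · simp only [hw, trunc_of_notMem hx]
      exact continuousOn_const
  have hcF : ContinuousOn F (Icc T₀ 0) :=
    continuousOn_finsetSum _ fun x hx => continuousOn_const.mul ((hcv x hx).pow 2)
  have hcG : ContinuousOn G (Icc T₀ 0) :=
    (continuousOn_const.mul (continuousOn_finsetSum _ fun x hx =>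
      continuousOn_const.mul ((hcv x hx).pow 2))).add
    (continuousOn_const.mul (continuousOn_finsetSum _ fun x hx =>
      continuousOn_const.mul (hcv x hx)))
  have hcE : ContinuousOn E (Icc T₀ 0) :=
    continuousOn_finsetSum _ fun x _ => continuousOn_finsetSum _ fun y _ =>
      continuousOn_const.mul (((hcw x).sub (hcw y)).pow 2)
  have hcY : ContinuousOn (fun t => ∑ x ∈ B, W x * max (u t x - k) 0 ^ 2) (Icc T₀ 0) :=
    hu.continuousOn_mass_integrand k hr₀ hT₀
  have hderiv : ∀ t ∈ Ioo T₀ 0, HasDerivAt F (F' t) t := by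
    intro t ht
    refine HasDerivAt.fun_sum fun x hx => HasDerivAt.const_mul _ ?_
    exact (hasDerivAt_max_zero_sq (u t x - k')).comp t
      ((hu.deriv t ⟨hT₀.trans ht.1, ht.2⟩ x (hBn hx)).sub_const k')
  have hle : ∀ t ∈ Ioo T₀ 0, F' t ≤ G t - E t := fun t ht =>
    h.caccioppoli hBΛ (hu.bound t (hIcc t ⟨ht.1.le, ht.2.le⟩)) (by linarith) hδ
      (abs_cutoff_sub_le hδ) cutoff_sq_le_one hfar
  obtain ⟨hsup, hint⟩ := energy_estimate hT hT₁ hcF hcE hcG hderiv hle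
    (fun t _ => Finset.sum_nonneg fun x _ => mul_nonneg (sq_nonneg _) (sq_nonneg _))
    (fun t _ => h.energy_nonneg _ _)
    (fun t _ => add_nonneg
      (mul_nonneg (sq_nonneg _) (Finset.sum_nonneg fun x _ =>
        mul_nonneg (h.left_nonneg x) (sq_nonneg _)))
      (mul_nonneg hUδ (Finset.sum_nonneg fun x _ =>
        mul_nonneg (h.left_nonneg x) (le_max_right _ _))))
  have hI : ∫ s in T₀..0, F s + |T₀| * G s ≤
      (1 + (n : ℝ) ^ 2 * (δ⁻¹ ^ 2 + 2 * U * δ ^ (-m) * g⁻¹)) * mass W u k r₀ T₀ := by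
    rw [mass, ← intervalIntegral.integral_const_mul]
    refine intervalIntegral.integral_mono_on hT₀0.le
      ((hcF.add (continuousOn_const.mul hcG)).intervalIntegrable_of_Icc hT₀0.le)
      ((continuousOn_const.mul hcY).intervalIntegrable_of_Icc hT₀0.le) fun t ht => ?_
    have hsq : ∀ x, max (u t x - k') 0 ^ 2 ≤ max (u t x - k) 0 ^ 2 := fun x =>
      pow_le_pow_left₀ (le_max_right _ _) (max_le_max_right _ (by linarith)) 2
    -- First gap: where `u > k'`, also `u - k ≥ g`, so the linear tail term is bounded by the
    -- quadratic mass at level `k`.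
    have hlin : ∀ x, max (u t x - k') 0 ≤ g⁻¹ * max (u t x - k) 0 ^ 2 := by
      intro x
      rw [← div_eq_inv_mul, le_div_iff₀ hg]
      rcases le_total (u t x - k') 0 with h0 | h0
      · rw [max_eq_right h0, zero_mul]; positivity
      · rw [max_eq_left h0, max_eq_left (by linarith)]
        nlinarith
    set S := ∑ x ∈ B, W x * max (u t x - k) 0 ^ 2 with hS
    have hS0 : 0 ≤ S := Finset.sum_nonneg fun x _ => mul_nonneg (h.left_nonneg x) (sq_nonneg _)
    have e1 : F t ≤ S := Finset.sum_le_sum fun x _ => by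
      refine mul_le_mul ((cutoff_sq_le_one x).trans (h.one_le_left x)) (hsq x) (sq_nonneg _)
        (h.left_nonneg x)
    have e2 : G t ≤ (δ⁻¹ ^ 2 + 2 * U * δ ^ (-m) * g⁻¹) * S := by
      rw [add_mul, mul_assoc (2 * U * δ ^ (-m))]
      refine add_le_add (mul_le_mul_of_nonneg_left (Finset.sum_le_sum fun x _ =>
        mul_le_mul_of_nonneg_left (hsq x) (h.left_nonneg x)) (sq_nonneg _))
        (mul_le_mul_of_nonneg_left ?_ hUδ)
      rw [Finset.mul_sum]
      refine Finset.sum_le_sum fun x _ => ?_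
      have := mul_le_mul_of_nonneg_left (hlin x) (h.left_nonneg x)
      linarith
    have e3 : |T₀| ≤ (n : ℝ) ^ 2 := by rw [abs_of_neg hT₀0]; linarith
    have e4 : |T₀| * G t ≤ (n : ℝ) ^ 2 * ((δ⁻¹ ^ 2 + 2 * U * δ ^ (-m) * g⁻¹) * S) := by
      refine (mul_le_mul_of_nonneg_left e2 (abs_nonneg _)).trans
        (mul_le_mul_of_nonneg_right e3 ?_)
      exact mul_nonneg (add_nonneg (sq_nonneg _) (mul_nonneg hUδ (inv_nonneg.2 hg.le))) hS0
    linarith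
  set J := (1 + (n : ℝ) ^ 2 * (δ⁻¹ ^ 2 + 2 * U * δ ^ (-m) * g⁻¹)) * mass W u k r₀ T₀ with hJ
  have hTT : 0 < T₁ - T₀ := sub_pos.2 hT
  set A := (T₁ - T₀)⁻¹ * J with hA
  have hFA : ∀ t ∈ Icc T₁ 0, F t ≤ A := fun t ht => by
    rw [hA, ← div_eq_inv_mul, le_div_iff₀ hTT, mul_comm]
    exact (hsup t ht).trans hI
  have hEA : ∫ s in T₁..0, E s ≤ A := by
    rw [hA, ← div_eq_inv_mul, le_div_iff₀ hTT, mul_comm]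
    exact hint.trans hI
  have hF0 : ∀ t, 0 ≤ F t := fun t =>
    Finset.sum_nonneg fun x _ => mul_nonneg (sq_nonneg _) (sq_nonneg _)
  have hA0 : 0 ≤ A := (hF0 0).trans (hFA 0 ⟨hT₁, le_rfl⟩)
  set K := (2 * d * (1 + ρ * (1 - b))) ^ 2 * (∑ x ∈ B, W x ^ a⁻¹) ^ a *
    (∑ x ∈ B, N x ^ b⁻¹) ^ b with hK
  have hK0 : 0 ≤ K := mul_nonneg (mul_nonneg (sq_nonneg _) (Real.rpow_nonneg
    (Finset.sum_nonneg fun x _ => Real.rpow_nonneg (h.left_nonneg x) _) _)) (Real.rpow_nonneg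
    (Finset.sum_nonneg fun x _ => Real.rpow_nonneg (h.right_nonneg x) _) _)
  have hgε : 0 ≤ (g⁻¹) ^ (2 * ε) := Real.rpow_nonneg (inv_nonneg.2 hg.le) _
  have hpt : ∀ t ∈ Icc T₁ 0, ∑ x ∈ ball d r₁, W x * max (u t x - (k + 2 * g)) 0 ^ 2 ≤
      (g⁻¹) ^ (2 * ε) * K * A ^ ε * E t := by
    intro t ht
    have h1 := h.sum_weight_rpow_le hd ha hb hb1 hρ hρb hε hsum (hw0 t) (hwB t) hBΛ hnb hnb'
    have h2 : ∑ x ∈ B, w t x ^ 2 = F t := Finset.sum_congr rfl fun x hx => by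
      simp only [hw, trunc_of_mem hx]; ring
    rw [h2] at h1
    have h3 : ∑ x ∈ ball d r₁, W x * max (u t x - (k + 2 * g)) 0 ^ 2 ≤
        (g⁻¹) ^ (2 * ε) * ∑ x ∈ B, W x * w t x ^ (2 + 2 * ε) := by
      rw [Finset.mul_sum]
      refine (Finset.sum_le_sum fun x hx => ?_).trans (Finset.sum_le_sum_of_subset_of_nonneg
        (ball_mono (by linarith)) fun x _ _ => mul_nonneg hgε (mul_nonneg (h.left_nonneg x)
          (Real.rpow_nonneg (hw0 t x) _)))
      have hwx : w t x = max (u t x - k') 0 := by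
        have hxB : x ∈ B := ball_mono (by linarith) hx
        simp only [hw, trunc_of_mem hxB, hφ, cutoff_eq_one hδ hx, one_mul]
      rw [hwx]
      have hnn : 0 ≤ (g⁻¹) ^ (2 * ε) * (W x * max (u t x - k') 0 ^ (2 + 2 * ε)) :=
        mul_nonneg hgε (mul_nonneg (h.left_nonneg x) (Real.rpow_nonneg (le_max_right _ _) _))
      rcases le_total (u t x - (k + 2 * g)) 0 with h0 | h0
      · rw [max_eq_right h0]; simpa using hnn
      · have hv : g ≤ max (u t x - k') 0 := le_max_of_le_left (by linarith)
        have hv0 : 0 < max (u t x - k') 0 := hg.trans_le hv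
        have h5 : max (u t x - (k + 2 * g)) 0 ^ 2 ≤ max (u t x - k') 0 ^ 2 :=
          pow_le_pow_left₀ (le_max_right _ _) (max_le_max_right _ (by linarith)) 2
        have h6 : 1 ≤ (g⁻¹ * max (u t x - k') 0) ^ (2 * ε) := by
          refine Real.one_le_rpow ?_ (by positivity)
          rw [← div_eq_inv_mul, one_le_div hg]
          exact hv
        have h7 : (g⁻¹) ^ (2 * ε) * (W x * max (u t x - k') 0 ^ (2 + 2 * ε)) =
            (W x * max (u t x - k') 0 ^ 2) * (g⁻¹ * max (u t x - k') 0) ^ (2 * ε) := by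
          rw [Real.rpow_add hv0, Real.mul_rpow (inv_nonneg.2 hg.le) hv0.le]
          norm_num
          ring
        rw [h7]
        refine (mul_le_mul_of_nonneg_left h5 (h.left_nonneg x)).trans ?_
        exact le_mul_of_one_le_right (mul_nonneg (h.left_nonneg x) (sq_nonneg _)) h6
    refine h3.trans ?_
    have h4 : K * E t * F t ^ ε ≤ K * E t * A ^ ε :=
      mul_le_mul_of_nonneg_left (Real.rpow_le_rpow (hF0 t) (hFA t ht) hε.le)
        (mul_nonneg hK0 (h.energy_nonneg _ _))
    have h5 := mul_le_mul_of_nonneg_left (h1.trans h4) hgε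
    linarith
  have hcY1 : ContinuousOn (fun t => ∑ x ∈ ball d r₁, W x * max (u t x - (k + 2 * g)) 0 ^ 2)
      (Icc T₁ 0) := hu.continuousOn_mass_integrand _ (by linarith) (hT₀.trans hT)
  have hAε : A ^ (1 + ε) = A ^ ε * A := by
    rw [add_comm, Real.rpow_add_of_nonneg hA0 hε.le zero_le_one, Real.rpow_one]
  calc mass W u (k + 2 * g) r₁ T₁ ≤ ∫ t in T₁..0, (g⁻¹) ^ (2 * ε) * K * A ^ ε * E t := by
        refine intervalIntegral.integral_mono_on hT₁ (hcY1.intervalIntegrable_of_Icc hT₁)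
          ((continuousOn_const.mul (hcE.mono (Icc_subset_Icc hT.le le_rfl))
            ).intervalIntegrable_of_Icc hT₁) hpt
    _ = (g⁻¹) ^ (2 * ε) * K * A ^ ε * ∫ t in T₁..0, E t :=
        intervalIntegral.integral_const_mul _ _
    _ ≤ (g⁻¹) ^ (2 * ε) * K * A ^ ε * A := mul_le_mul_of_nonneg_left hEA
        (mul_nonneg (mul_nonneg hgε hK0) (Real.rpow_nonneg hA0 _))
    _ = _ := by rw [hAε]; ring

end Step

/-! ### The De Giorgi iteration -/

/-- Fast geometric convergence. -/
theorem le_geometric_of_superlinear {Y : ℕ → ℝ} {D β ε : ℝ} (hY : ∀ j, 0 ≤ Y j) (hD : 0 ≤ D)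
    (hβ : 0 < β) (hε : 0 < ε) (hstep : ∀ j, Y (j + 1) ≤ D * β ^ j * Y j ^ (1 + ε))
    (h0 : D * β ^ ε⁻¹ * Y 0 ^ ε ≤ 1) (j : ℕ) : Y j ≤ Y 0 * ((β ^ ε⁻¹)⁻¹) ^ j := by
  have hb : 0 < β ^ ε⁻¹ := Real.rpow_pos_of_pos hβ _
  set q := (β ^ ε⁻¹)⁻¹ with hq
  have hq0 : 0 < q := inv_pos.2 hb
  have hqε : q ^ ε = β⁻¹ := by
    rw [hq, Real.inv_rpow hb.le, Real.rpow_inv_rpow hβ.le hε.ne']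
  induction j with
  | zero => simp
  | succ j ih =>
    have h1 : D * Y 0 ^ ε ≤ q := by
      rw [hq, ← one_div, le_div_iff₀ hb]
      linarith
    have h2 : (q ^ j) ^ ε = (β ^ j)⁻¹ := by
      rw [← Real.rpow_natCast, ← Real.rpow_mul hq0.le, mul_comm, Real.rpow_mul hq0.le, hqε,
        Real.rpow_natCast, inv_pow]
    calc Y (j + 1) ≤ D * β ^ j * Y j ^ (1 + ε) := hstep j
      _ ≤ D * β ^ j * (Y 0 * q ^ j) ^ (1 + ε) := by
          refine mul_le_mul_of_nonneg_left (Real.rpow_le_rpow (hY j) ih (by linarith)) ?_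
          positivity
      _ = (Y 0 * q ^ j) * (D * Y 0 ^ ε) := by
          have h3 : 0 ≤ Y 0 * q ^ j := mul_nonneg (hY 0) (by positivity)
          rw [Real.rpow_add_of_nonneg h3 zero_le_one hε.le, Real.rpow_one,
            Real.mul_rpow (hY 0) (by positivity), h2]
          have : β ^ j ≠ 0 := by positivity
          field_simp
      _ ≤ (Y 0 * q ^ j) * q :=
          mul_le_mul_of_nonneg_left h1 (mul_nonneg (hY 0) (by positivity))
      _ = Y 0 * q ^ (j + 1) := by ring

theorem mul_rearrange_le {x t₁ t₂ t₃ K C y : ℝ} (h : t₁ * t₂ ≤ t₃) (hx : 0 ≤ x) (hK : 0 ≤ K)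
    (hC : 0 ≤ C) (hy : 0 ≤ y) : x * t₁ * K * (C * t₂ * y) ≤ x * (K * C) * t₃ * y := by
  have := mul_le_mul_of_nonneg_left h (mul_nonneg (mul_nonneg hx (mul_nonneg hK hC)) hy)
  linarith

section DeGiorgi

variable {d : ℕ} {c : (Fin d → ℤ) → (Fin d → ℤ) → ℝ} {m : ℝ} {W N : (Fin d → ℤ) → ℝ}

theorem IsDominated.mass_nonneg (h : IsDominated c m W N) (u : ℝ → (Fin d → ℤ) → ℝ)
    {k r T : ℝ} (hT : T ≤ 0) : 0 ≤ mass W u k r T :=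
  intervalIntegral.integral_nonneg hT fun _ _ => Finset.sum_nonneg fun x _ =>
    mul_nonneg (h.left_nonneg x) (sq_nonneg _)

theorem IsDominated.mass_mono (h : IsDominated c m W N) {n : ℕ} {U : ℝ}
    {u : ℝ → (Fin d → ℤ) → ℝ} (hu : IsBoundedCaloric c n U u) {k k' r r' T T' : ℝ}
    (hk : k ≤ k') (hr : r' ≤ r) (hrn : r ≤ n) (hT : T ≤ T') (hT' : T' ≤ 0)
    (hTn : -(n : ℝ) ^ 2 < T) : mass W u k' r' T' ≤ mass W u k r T := by
  have hc := hu.continuousOn_mass_integrand (W := W) k hrn hTn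
  have hc' := hu.continuousOn_mass_integrand (W := W) k' (hr.trans hrn) (hTn.trans_le hT)
  have hnn : ∀ t x, 0 ≤ W x * max (u t x - k) 0 ^ 2 := fun t x =>
    mul_nonneg (h.left_nonneg x) (sq_nonneg _)
  calc mass W u k' r' T' ≤ mass W u k r T' := by
        refine intervalIntegral.integral_mono_on hT' (hc'.intervalIntegrable_of_Icc hT')
          ((hc.mono (Icc_subset_Icc hT le_rfl)).intervalIntegrable_of_Icc hT') fun t _ => ?_
        refine (Finset.sum_le_sum fun x _ => ?_).trans
          (Finset.sum_le_sum_of_subset_of_nonneg (ball_mono hr) fun x _ _ => hnn t x)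
        exact mul_le_mul_of_nonneg_left (pow_le_pow_left₀ (le_max_right _ _)
          (max_le_max_right _ (by linarith)) 2) (h.left_nonneg x)
    _ ≤ mass W u k r T :=
        intervalIntegral.integral_mono_interval hT hT' le_rfl
          (Filter.Eventually.of_forall fun t => Finset.sum_nonneg fun x _ => hnn t x)
          (hc.intervalIntegrable_of_Icc (hT.trans hT'))

theorem IsDominated.le_of_mass_nonpos (h : IsDominated c m W N) {n : ℕ} {U : ℝ}
    {u : ℝ → (Fin d → ℤ) → ℝ} (hu : IsBoundedCaloric c n U u) {k r T : ℝ} (hrn : r ≤ n)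
    (hT : T < 0) (hTn : -(n : ℝ) ^ 2 < T) (hmass : mass W u k r T ≤ 0) :
    ∀ t ∈ Icc T 0, ∀ x ∈ ball d r, u t x ≤ k := by
  intro t ht x hx
  by_contra! hlt
  have hnn : ∀ s y, 0 ≤ W y * max (u s y - k) 0 ^ 2 := fun s y =>
    mul_nonneg (h.left_nonneg y) (sq_nonneg _)
  refine absurd hmass (not_le.2 ?_)
  refine intervalIntegral.integral_pos hT (hu.continuousOn_mass_integrand k hrn hTn)
    (fun s _ => Finset.sum_nonneg fun y _ => hnn s y) ⟨t, ht, ?_⟩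
  refine lt_of_lt_of_le ?_ (Finset.single_le_sum (fun y _ => hnn t y) hx)
  have h1 : 0 < u t x - k := by linarith
  rw [max_eq_left h1.le]
  exact mul_pos (zero_lt_one.trans_le (h.one_le_left x)) (by positivity)

/-- The Sobolev constant times the unnormalised norms of `W` and `N` over `B_r`. -/
noncomputable def stepConst (W N : (Fin d → ℤ) → ℝ) (a b ρ r : ℝ) : ℝ :=
  (2 * d * (1 + ρ * (1 - b))) ^ 2 * (∑ x ∈ ball d r, W x ^ a⁻¹) ^ a *
    (∑ x ∈ ball d r, N x ^ b⁻¹) ^ b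

theorem IsDominated.sum_left_rpow_nonneg (h : IsDominated c m W N) (s : ℝ)
    (B : Finset (Fin d → ℤ)) : 0 ≤ ∑ x ∈ B, W x ^ s :=
  Finset.sum_nonneg fun x _ => Real.rpow_nonneg (h.left_nonneg x) _

theorem IsDominated.sum_right_rpow_nonneg (h : IsDominated c m W N) (s : ℝ)
    (B : Finset (Fin d → ℤ)) : 0 ≤ ∑ x ∈ B, N x ^ s :=
  Finset.sum_nonneg fun x _ => Real.rpow_nonneg (h.right_nonneg x) _

theorem IsDominated.stepConst_nonneg (h : IsDominated c m W N) (a b ρ r : ℝ) :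
    0 ≤ stepConst W N a b ρ r :=
  mul_nonneg (mul_nonneg (sq_nonneg _) (Real.rpow_nonneg (h.sum_left_rpow_nonneg _ _) _))
    (Real.rpow_nonneg (h.sum_right_rpow_nonneg _ _) _)

theorem IsDominated.stepConst_mono (h : IsDominated c m W N) {a b : ℝ} (ha : 0 < a) (hb : 0 < b)
    (ρ : ℝ) {r r' : ℝ} (hr : r ≤ r') : stepConst W N a b ρ r ≤ stepConst W N a b ρ r' := by
  have hW : ∑ x ∈ ball d r, W x ^ a⁻¹ ≤ ∑ x ∈ ball d r', W x ^ a⁻¹ :=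
    Finset.sum_le_sum_of_subset_of_nonneg (ball_mono hr)
      fun x _ _ => Real.rpow_nonneg (h.left_nonneg x) _
  have hN : ∑ x ∈ ball d r, N x ^ b⁻¹ ≤ ∑ x ∈ ball d r', N x ^ b⁻¹ :=
    Finset.sum_le_sum_of_subset_of_nonneg (ball_mono hr)
      fun x _ _ => Real.rpow_nonneg (h.right_nonneg x) _
  have hW0 := h.sum_left_rpow_nonneg a⁻¹ (ball d r)
  have hW0' := h.sum_left_rpow_nonneg a⁻¹ (ball d r')
  have hN0 := h.sum_right_rpow_nonneg b⁻¹ (ball d r)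
  unfold stepConst
  gcongr

/-- The recursion for the masses at level `kk (1 - s)`, radius `(θ₁ + lam s) n` and time
`-(θ₁ + lam s) n²` when `s` is halved. -/
theorem IsDominated.mass_halving (h : IsDominated c m W N) (hd : 2 ≤ d) {a b ρ ε : ℝ}
    (ha : 0 < a) (hb : 0 < b) (hb1 : b < 1) (hρ : 0 < ρ) (hρb : ρ⁻¹ = 1 - 2 / d + b)
    (hε : 0 < ε) (hsum : a + ρ⁻¹ + ε = 1) {n : ℕ} {U : ℝ} {u : ℝ → (Fin d → ℤ) → ℝ}
    (hu : IsBoundedCaloric c n U u) {θ₁ lam kk s : ℝ} (hθ₁ : 0 < θ₁) (hlam : 0 < lam)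
    (hθ₂ : θ₁ + lam < 1) (hkk : 0 < kk) (hUk : U ≤ kk * (n : ℝ) ^ (m - 2)) (hs : 0 < s)
    (hs1 : s ≤ 1) :
    mass W u (kk * (1 - s / 2)) ((θ₁ + lam * (s / 2)) * n) (-((θ₁ + lam * (s / 2)) * n ^ 2)) ≤
      kk ^ (-(2 * ε)) * (stepConst W N a b ρ ((θ₁ + lam) * n) *
        (4 * ((n : ℝ) ^ 2)⁻¹) ^ (1 + ε)) * (lam * s / 4) ^ (-((m + 3) * (1 + ε))) *
      mass W u (kk * (1 - s)) ((θ₁ + lam * s) * n) (-((θ₁ + lam * s) * n ^ 2)) ^ (1 + ε) := by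
  have hn1 : (1 : ℝ) ≤ n := by exact_mod_cast hu.one_le
  have hn0 : (0 : ℝ) < n := by linarith
  have hm := h.two_le
  have hls : lam * s ≤ lam := mul_le_of_le_one_right hlam.le hs1
  -- With this unit the step has `δ = n τ` and `T₁ - T₀ = 2 n² τ`; since `lam < 1`, also `g = kk s /
  -- 4 ≥ kk τ`. Every loss is thus a negative power of `τ`.
  set τ := lam * s / 4 with hτ
  have hτ0 : 0 < τ := by positivity
  have hτ1 : τ ≤ 1 := by linarith
  have hn2 : (0 : ℝ) < (n : ℝ) ^ 2 := by positivity
  have hε1 : ε < 1 := by have := inv_pos.2 hρ; linarith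
  set Y := mass W u (kk * (1 - s)) ((θ₁ + lam * s) * n) (-((θ₁ + lam * s) * n ^ 2)) with hY
  have hpos : 0 < θ₁ + lam * s := by positivity
  have hY0 : 0 ≤ Y := h.mass_nonneg u (by nlinarith)
  have hstep := h.mass_step hd ha hb hb1 hρ hρb hε hsum hu (k := kk * (1 - s))
    (g := kk * (s / 4)) (r₀ := (θ₁ + lam * s) * n) (r₁ := (θ₁ + lam * (s / 2)) * n)
    (T₀ := -((θ₁ + lam * s) * n ^ 2)) (T₁ := -((θ₁ + lam * (s / 2)) * n ^ 2)) (δ := n * τ)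
    (mul_nonneg hkk.le (by linarith)) (by positivity) (by positivity)
    (le_of_eq (by rw [hτ]; ring)) (by nlinarith) (by nlinarith) (by nlinarith [mul_pos hlam hs])
    (by have : 0 < θ₁ + lam * (s / 2) := by positivity
        nlinarith)
  rw [show kk * (1 - s) + 2 * (kk * (s / 4)) = kk * (1 - s / 2) by ring] at hstep
  refine hstep.trans ?_
  have hU : 0 ≤ U := (abs_nonneg _).trans (hu.bound 0 ⟨by linarith, le_rfl⟩ 0)
  have hpw : ∀ {x y : ℝ}, x ≤ y → τ ^ (-x) ≤ τ ^ (-y) := fun hxy =>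
    Real.rpow_le_rpow_of_exponent_ge hτ0 hτ1 (neg_le_neg hxy)
  have hginv : (kk * (s / 4))⁻¹ ≤ kk⁻¹ * τ ^ (-1 : ℝ) := by
    rw [Real.rpow_neg_one, ← mul_inv]
    refine inv_anti₀ (by positivity) (mul_le_mul_of_nonneg_left ?_ hkk.le)
    rw [hτ]
    nlinarith
  have hg1 : ((kk * (s / 4))⁻¹) ^ (2 * ε) ≤ kk ^ (-(2 * ε)) * τ ^ (-(2 * ε)) := by
    refine (Real.rpow_le_rpow (by positivity) hginv (by positivity)).trans (le_of_eq ?_)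
    rw [Real.mul_rpow (by positivity) (by positivity), Real.rpow_neg_one, Real.inv_rpow hkk.le,
      Real.inv_rpow hτ0.le, Real.rpow_neg hkk.le, Real.rpow_neg hτ0.le]
  have hfac : 1 + (n : ℝ) ^ 2 * ((n * τ)⁻¹ ^ 2 + 2 * U * (n * τ) ^ (-m) * (kk * (s / 4))⁻¹) ≤
      4 * τ ^ (-(m + 1)) := by
    have e1 : 1 ≤ τ ^ (-(m + 1)) := by
      have := hpw (show (0 : ℝ) ≤ m + 1 by linarith)
      simpa using this
    have e2 : (n : ℝ) ^ 2 * (n * τ)⁻¹ ^ 2 ≤ τ ^ (-(m + 1)) := by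
      have := hpw (show (2 : ℝ) ≤ m + 1 by linarith)
      rw [Real.rpow_neg hτ0.le 2, Real.rpow_two] at this
      refine le_trans (le_of_eq ?_) this
      field_simp
    -- Here `U ≤ kk n^{m-2}` makes the tail independent of `n`. The jump distance contributes
    -- `τ^{-m}` and the level gap one more factor.
    have e3 : (n : ℝ) ^ 2 * (U * (n * τ) ^ (-m) * (kk * (s / 4))⁻¹) ≤ τ ^ (-(m + 1)) := by
      have hnm : (n : ℝ) ^ (m - 2) * (n : ℝ) ^ (-m) = ((n : ℝ) ^ 2)⁻¹ := by
        rw [← Real.rpow_add hn0, ← Real.rpow_two, ← Real.rpow_neg hn0.le]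
        congr 1; ring
      have hτm : τ ^ (-m) * τ ^ (-1 : ℝ) = τ ^ (-(m + 1)) := by
        rw [← Real.rpow_add hτ0]; congr 1; ring
      calc (n : ℝ) ^ 2 * (U * (n * τ) ^ (-m) * (kk * (s / 4))⁻¹)
          ≤ (n : ℝ) ^ 2 * (kk * (n : ℝ) ^ (m - 2) * (n * τ) ^ (-m) * (kk⁻¹ * τ ^ (-1 : ℝ))) := by
            gcongr
        _ = ((n : ℝ) ^ 2 * ((n : ℝ) ^ (m - 2) * (n : ℝ) ^ (-m))) * (kk * kk⁻¹) *
              (τ ^ (-m) * τ ^ (-1 : ℝ)) := by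
            rw [Real.mul_rpow hn0.le hτ0.le]; ring
        _ = τ ^ (-(m + 1)) := by
            rw [hnm, hτm, mul_inv_cancel₀ hn2.ne', mul_inv_cancel₀ hkk.ne']; ring
    linarith
  have hTd : -((θ₁ + lam * (s / 2)) * (n : ℝ) ^ 2) - -((θ₁ + lam * s) * (n : ℝ) ^ 2) =
      2 * ((n : ℝ) ^ 2 * τ) := by
    rw [hτ]; ring
  have hTinv : (-((θ₁ + lam * (s / 2)) * (n : ℝ) ^ 2) - -((θ₁ + lam * s) * (n : ℝ) ^ 2))⁻¹ ≤
      ((n : ℝ) ^ 2)⁻¹ * τ ^ (-1 : ℝ) := by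
    rw [Real.rpow_neg_one, ← mul_inv]
    refine inv_anti₀ (by positivity) ?_
    rw [hTd]
    linarith [mul_pos hn2 hτ0]
  have hτ2 : τ ^ (-(m + 1)) * τ ^ (-1 : ℝ) = τ ^ (-(m + 2)) := by
    rw [← Real.rpow_add hτ0]; congr 1; ring
  have hA : (-((θ₁ + lam * (s / 2)) * (n : ℝ) ^ 2) - -((θ₁ + lam * s) * (n : ℝ) ^ 2))⁻¹ *
      ((1 + (n : ℝ) ^ 2 * ((n * τ)⁻¹ ^ 2 + 2 * U * (n * τ) ^ (-m) * (kk * (s / 4))⁻¹)) * Y) ≤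
      4 * ((n : ℝ) ^ 2)⁻¹ * τ ^ (-(m + 2)) * Y := by
    rw [← mul_assoc]
    refine mul_le_mul_of_nonneg_right ?_ hY0
    refine (mul_le_mul hTinv hfac (by positivity) (by positivity)).trans (le_of_eq ?_)
    rw [← hτ2]; ring
  have hA0 : 0 ≤ (-((θ₁ + lam * (s / 2)) * (n : ℝ) ^ 2) - -((θ₁ + lam * s) * (n : ℝ) ^ 2))⁻¹ *
      ((1 + (n : ℝ) ^ 2 * ((n * τ)⁻¹ ^ 2 + 2 * U * (n * τ) ^ (-m) * (kk * (s / 4))⁻¹)) * Y) := by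
    refine mul_nonneg (inv_nonneg.2 ?_) (by positivity)
    rw [hTd]
    positivity
  have hA2 := Real.rpow_le_rpow hA0 hA (show 0 ≤ 1 + ε by linarith)
  have hR : (4 * ((n : ℝ) ^ 2)⁻¹ * τ ^ (-(m + 2)) * Y) ^ (1 + ε) =
      (4 * ((n : ℝ) ^ 2)⁻¹) ^ (1 + ε) * τ ^ (-(m + 2) * (1 + ε)) * Y ^ (1 + ε) := by
    rw [Real.mul_rpow (by positivity) hY0, Real.mul_rpow (by positivity) (by positivity),
      ← Real.rpow_mul hτ0.le]
  rw [hR] at hA2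
  have hK : stepConst W N a b ρ ((θ₁ + lam * s) * n) ≤ stepConst W N a b ρ ((θ₁ + lam) * n) :=
    h.stepConst_mono ha hb ρ (mul_le_mul_of_nonneg_right (by linarith) hn0.le)
  have hK0 := h.stepConst_nonneg a b ρ ((θ₁ + lam * s) * n)
  have hK0' := h.stepConst_nonneg a b ρ ((θ₁ + lam) * n)
  -- Since `ε < 1`, the power `2ε` lost to the level gap is at most `1 + ε`, which raises `m + 2` to
  -- `m + 3`.
  have hτΓ : τ ^ (-(2 * ε)) * τ ^ (-(m + 2) * (1 + ε)) ≤ τ ^ (-((m + 3) * (1 + ε))) := by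
    rw [← Real.rpow_add hτ0, show -(2 * ε) + -(m + 2) * (1 + ε) =
      -(2 * ε + (m + 2) * (1 + ε)) by ring]
    exact hpw (by linarith)
  have hYε : 0 ≤ Y ^ (1 + ε) := Real.rpow_nonneg hY0 _
  have hC0 : 0 ≤ (4 * ((n : ℝ) ^ 2)⁻¹) ^ (1 + ε) := by positivity
  have hkε : 0 ≤ kk ^ (-(2 * ε)) := Real.rpow_nonneg hkk.le _
  have hτε : 0 ≤ τ ^ (-(2 * ε)) := Real.rpow_nonneg hτ0.le _
  refine le_trans (mul_le_mul (mul_le_mul hg1 hK hK0 (mul_nonneg hkε hτε)) hA2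
    (Real.rpow_nonneg hA0 _) (mul_nonneg (mul_nonneg hkε hτε) hK0')) ?_
  exact mul_rearrange_le hτΓ hkε hK0' hC0 hYε

/-- Iterate `mass_halving` along `s = 2^{-j}`. The smallness condition is that of fast geometric
convergence, so the mass at the limiting level and cylinder vanishes; as `W` is positive and `u`
continuous in time, `u` cannot exceed `kk` there. -/
theorem IsDominated.le_of_small_mass (h : IsDominated c m W N) (hd : 2 ≤ d) {a b ρ ε : ℝ}
    (ha : 0 < a) (hb : 0 < b) (hb1 : b < 1) (hρ : 0 < ρ) (hρb : ρ⁻¹ = 1 - 2 / d + b)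
    (hε : 0 < ε) (hsum : a + ρ⁻¹ + ε = 1) {n : ℕ} {U : ℝ} {u : ℝ → (Fin d → ℤ) → ℝ}
    (hu : IsBoundedCaloric c n U u) {θ₁ lam kk : ℝ} (hθ₁ : 0 < θ₁) (hlam : 0 < lam)
    (hθ₂ : θ₁ + lam < 1) (hkk : 0 < kk) (hUk : U ≤ kk * (n : ℝ) ^ (m - 2))
    (hsmall : kk ^ (-(2 * ε)) * (stepConst W N a b ρ ((θ₁ + lam) * n) *
        (4 * ((n : ℝ) ^ 2)⁻¹) ^ (1 + ε)) * (lam / 4) ^ (-((m + 3) * (1 + ε))) *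
        ((2 : ℝ) ^ ((m + 3) * (1 + ε))) ^ ε⁻¹ *
      mass W u 0 ((θ₁ + lam) * n) (-((θ₁ + lam) * n ^ 2)) ^ ε ≤ 1) :
    ∀ t ∈ Icc (-(θ₁ * (n : ℝ) ^ 2)) 0, ∀ x ∈ ball d (θ₁ * n), u t x ≤ kk := by
  have hn1 : (1 : ℝ) ≤ n := by exact_mod_cast hu.one_le
  have hn0 : (0 : ℝ) < n := by linarith
  have hn2 : (0 : ℝ) < (n : ℝ) ^ 2 := by positivity
  set Γ := (m + 3) * (1 + ε) with hΓ
  have hΓ0 : 0 < Γ := mul_pos (by linarith [h.two_le]) (by linarith)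
  set s : ℕ → ℝ := fun j => (1 / 2) ^ j with hsdef
  have hs0 : ∀ j, 0 < s j := fun j => by positivity
  have hs1 : ∀ j, s j ≤ 1 := fun j => pow_le_one₀ (by norm_num) (by norm_num)
  have hls : ∀ j, lam * s j ≤ lam := fun j => mul_le_of_le_one_right hlam.le (hs1 j)
  set Y : ℕ → ℝ := fun j =>
    mass W u (kk * (1 - s j)) ((θ₁ + lam * s j) * n) (-((θ₁ + lam * s j) * n ^ 2)) with hY
  have hpos : ∀ j, 0 < θ₁ + lam * s j := fun j => by have := hs0 j; positivity
  have hY0 : ∀ j, 0 ≤ Y j := fun j => h.mass_nonneg u (by nlinarith [hpos j])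
  have hK0 := h.stepConst_nonneg a b ρ ((θ₁ + lam) * n)
  have hstep : ∀ j, Y (j + 1) ≤ kk ^ (-(2 * ε)) * (stepConst W N a b ρ ((θ₁ + lam) * n) *
        (4 * ((n : ℝ) ^ 2)⁻¹) ^ (1 + ε)) * (lam / 4) ^ (-Γ) * ((2 : ℝ) ^ Γ) ^ j *
      Y j ^ (1 + ε) := by
    intro j
    have h1 := h.mass_halving hd ha hb hb1 hρ hρb hε hsum hu hθ₁ hlam hθ₂ hkk hUk (hs0 j) (hs1 j)
    have h2 : s j / 2 = s (j + 1) := by simp only [hsdef, pow_succ]; ring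
    rw [h2] at h1
    refine h1.trans (le_of_eq ?_)
    have h3 : (lam * s j / 4) ^ (-Γ) = (lam / 4) ^ (-Γ) * ((2 : ℝ) ^ Γ) ^ j := by
      rw [show lam * s j / 4 = (lam / 4) * s j by ring,
        Real.mul_rpow (by positivity) (hs0 j).le]
      congr 1
      simp only [hsdef]
      rw [one_div, inv_pow, Real.inv_rpow (by positivity), Real.rpow_neg (by positivity), inv_inv,
        ← Real.rpow_natCast, ← Real.rpow_natCast, ← Real.rpow_mul (by norm_num),
        ← Real.rpow_mul (by norm_num), mul_comm]
    rw [h3]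
    ring
  have hY00 : Y 0 = mass W u 0 ((θ₁ + lam) * n) (-((θ₁ + lam) * n ^ 2)) := by
    simp [hY, hsdef]
  have hgeo := le_geometric_of_superlinear hY0 (by positivity) (Real.rpow_pos_of_pos two_pos Γ) hε
    hstep (by rw [hY00]; exact hsmall)
  set q := (((2 : ℝ) ^ Γ) ^ ε⁻¹)⁻¹ with hq
  have hq1 : q < 1 := inv_lt_one_of_one_lt₀ <|
    Real.one_lt_rpow (Real.one_lt_rpow one_lt_two hΓ0) (inv_pos.2 hε)
  have hq0 : 0 ≤ q := by positivity
  have hlim : Filter.Tendsto (fun j => Y 0 * q ^ j) Filter.atTop (nhds 0) := by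
    simpa using (tendsto_pow_atTop_nhds_zero_of_lt_one hq0 hq1).const_mul (Y 0)
  refine h.le_of_mass_nonpos hu (by nlinarith) (by nlinarith) (by nlinarith) ?_
  refine ge_of_tendsto' hlim fun j => le_trans ?_ (hgeo j)
  have e1 : 0 < lam * s j := mul_pos hlam (hs0 j)
  refine h.mass_mono hu ?_ ?_ ?_ ?_ ?_ ?_
  · nlinarith [hs0 j]
  · nlinarith
  · nlinarith [hls j]
  · nlinarith
  · nlinarith
  · nlinarith [hls j]

end DeGiorgi

/-! ### Absorption of the supremum -/

/-- Absorption of half of the supremum over a slightly larger domain by iteration. -/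
theorem le_of_half_absorption {bd : ℝ → ℝ → Prop} {θ₀ θ₁ hh A κ K : ℝ} (hκ : 1 ≤ κ)
    (hA : 0 ≤ A) (hh0 : 0 ≤ hh) (hK0 : 0 ≤ K)
    (hmono : ∀ θ s s', s ≤ s' → bd θ s → bd θ s')
    (hclosed : ∀ θ s, (∀ e > 0, bd θ (s + e)) → bd θ s)
    (hK : ∀ θ, θ₁ ≤ θ → θ < θ₀ → bd θ K)
    (hstep : ∀ θ lam S, θ₁ ≤ θ → 0 < lam → θ + lam < θ₀ → 0 ≤ S → bd (θ + lam) S →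
      bd θ (hh + S / 2 + A * lam ^ (-κ))) (hθ : θ₁ < θ₀) :
    bd θ₁ (2 * hh + 4 * (3 * κ) ^ κ * A * (θ₀ - θ₁) ^ (-κ)) := by
  have hκ0 : 0 < κ := by linarith
  -- Each iteration uses the fraction `s` of the remaining gap. By Bernoulli `(1 - s)^κ ≥ 2/3`, so
  -- half of the inherited term is at most `3/4` of the target, and `c = 4 (3κ)^κ` makes the new
  -- term exactly the missing quarter.
  set s := 1 / (3 * κ) with hs
  have hs0 : 0 < s := by positivity
  have hκs : κ * s = 1 / 3 := by rw [hs]; field_simp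
  have hs1 : s < 1 := by nlinarith
  have hsκ : s ^ (-κ) = (3 * κ) ^ κ := by
    rw [hs, one_div, Real.inv_rpow (by positivity), Real.rpow_neg (by positivity), inv_inv]
  have h1s : (1 - s) ^ (-κ) ≤ 3 / 2 := by
    have h1 := one_add_mul_self_le_rpow_one_add (s := -s) (by linarith) hκ
    rw [← sub_eq_add_neg] at h1
    have h2 : 2 / 3 ≤ (1 - s) ^ κ := by linarith
    rw [Real.rpow_neg (by linarith)]
    calc ((1 - s) ^ κ)⁻¹ ≤ (2 / 3)⁻¹ := inv_anti₀ (by norm_num) h2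
      _ = 3 / 2 := by norm_num
  set c := 4 * (3 * κ) ^ κ with hc
  have hc0 : 0 ≤ c := by positivity
  have key : ∀ i : ℕ, ∀ θ, θ₁ ≤ θ → θ < θ₀ →
      bd θ (2 * hh + c * A * (θ₀ - θ) ^ (-κ) + (1 / 2) ^ i * K) := by
    intro i
    induction i with
    | zero =>
      intro θ h1 h2
      refine hmono _ _ _ ?_ (hK θ h1 h2)
      have : 0 ≤ c * A * (θ₀ - θ) ^ (-κ) :=
        mul_nonneg (mul_nonneg hc0 hA) (Real.rpow_nonneg (by linarith) _)
      simp only [pow_zero, one_mul]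
      linarith
    | succ i ih =>
      intro θ h1 h2
      have hΔ : 0 < θ₀ - θ := by linarith
      have hlam : 0 < s * (θ₀ - θ) := mul_pos hs0 hΔ
      have hlt : θ + s * (θ₀ - θ) < θ₀ := by nlinarith
      have h3 := ih (θ + s * (θ₀ - θ)) (by linarith) hlt
      rw [show θ₀ - (θ + s * (θ₀ - θ)) = (1 - s) * (θ₀ - θ) by ring,
        Real.mul_rpow (by linarith) hΔ.le] at h3
      have hD : 0 ≤ (θ₀ - θ) ^ (-κ) := Real.rpow_nonneg hΔ.le _
      have hcAD : 0 ≤ c * A * (θ₀ - θ) ^ (-κ) := mul_nonneg (mul_nonneg hc0 hA) hD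
      have hs' : 0 ≤ (1 - s) ^ (-κ) := Real.rpow_nonneg (by linarith) _
      refine hmono _ _ _ ?_ (hstep θ _ _ h1 hlam hlt ?_ h3)
      · rw [Real.mul_rpow hs0.le hΔ.le, hsκ, pow_succ]
        have := mul_le_mul_of_nonneg_left h1s hcAD
        have e : A * ((3 * κ) ^ κ * (θ₀ - θ) ^ (-κ)) = c * A * (θ₀ - θ) ^ (-κ) / 4 := by
          rw [hc]; ring
        rw [e]
        linarith
      · positivity
  refine hclosed _ _ fun e he => ?_
  obtain ⟨i, hi⟩ := exists_pow_lt_of_lt_one (show 0 < e / (K + 1) by positivity)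
    (show (1 / 2 : ℝ) < 1 by norm_num)
  refine hmono _ _ _ ?_ (key i θ₁ le_rfl hθ)
  have h1 : (1 / 2 : ℝ) ^ i * K ≤ e := by
    rw [lt_div_iff₀ (by linarith)] at hi
    have : (0 : ℝ) < (1 / 2) ^ i := by positivity
    linarith
  linarith

/-! ### Choice of the level -/

section Constants

/-- The constant in the smallness condition of the De Giorgi iteration. -/
noncomputable def iterConst (d : ℕ) (a b ρ ε Γ : ℝ) : ℝ :=
  9 * (2 * d * (1 + ρ * (1 - b))) ^ 2 * 4 ^ (1 + ε) * 4 ^ Γ * ((2 : ℝ) ^ Γ) ^ ε⁻¹ *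
    2 ^ ((1 + a) * ε)

/-- Scaling bookkeeping, with `β` the volume. The volume powers add up to `β^{a+b+ε} = β^{2/d} ≤ 9
n²`, which cancels the remaining `n^{-2}`. The prefactor `kk^{-2ε}` and the power `(1+a)ε` from the
interpolated mass leave `kk^{-(1-a)ε}`, so a large level suffices. -/
theorem smallness_of_level_large {d : ℕ} (hd : 0 < d) {a b ρ ε Γ n β P Q ps qs kk lam S l Y : ℝ}
    (ha : 0 < a) (ha1 : a < 1) (hε : 0 < ε) (habε : a + b + ε = 2 / d)
    (hn : 0 < n) (hβ0 : 0 < β) (hβ : β ≤ (3 * n) ^ d) (hP0 : 0 ≤ P) (hQ0 : 0 ≤ Q)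
    (hP : P ≤ β ^ a * ps) (hQ : Q ≤ β ^ b * qs)
    (hps : 1 ≤ ps) (hqs : 1 ≤ qs) (hkk : 0 < kk) (hlam : 0 < lam) (hS0 : 0 ≤ S)
    (hS : S ≤ 2 * kk) (hl : 0 < l) (hY0 : 0 ≤ Y)
    (hY : Y ≤ S ^ (1 + a) * (P * (n ^ 2 * (β * l) ^ (1 - a))))
    (hlevel : iterConst d a b ρ ε Γ * (ps * qs) ^ (1 + ε) * lam ^ (-Γ) * l ^ ((1 - a) * ε) ≤
      kk ^ ((1 - a) * ε)) :
    kk ^ (-(2 * ε)) * ((2 * d * (1 + ρ * (1 - b))) ^ 2 * P * Q *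
        (4 * (n ^ 2)⁻¹) ^ (1 + ε)) * (lam / 4) ^ (-Γ) * ((2 : ℝ) ^ Γ) ^ ε⁻¹ * Y ^ ε ≤ 1 := by
  have hps0 : 0 < ps := by linarith
  have hqs0 : 0 < qs := by linarith
  have hn2 : 0 < n ^ 2 := by positivity
  have hY1 : Y ≤ (2 * kk) ^ (1 + a) * (β * ps * (n ^ 2 * l ^ (1 - a))) := by
    refine hY.trans ?_
    have e1 : S ^ (1 + a) ≤ (2 * kk) ^ (1 + a) := Real.rpow_le_rpow hS0 hS (by linarith)
    have e2 : P * (n ^ 2 * (β * l) ^ (1 - a)) ≤ β * ps * (n ^ 2 * l ^ (1 - a)) := by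
      refine (mul_le_mul_of_nonneg_right hP (by positivity)).trans (le_of_eq ?_)
      have : β ^ a * β ^ (1 - a) = β := by
        rw [← Real.rpow_add hβ0, add_sub_cancel, Real.rpow_one]
      rw [Real.mul_rpow hβ0.le hl.le]
      calc β ^ a * ps * (n ^ 2 * (β ^ (1 - a) * l ^ (1 - a)))
          = (β ^ a * β ^ (1 - a)) * ps * (n ^ 2 * l ^ (1 - a)) := by ring
        _ = _ := by rw [this]
    exact mul_le_mul e1 e2 (by positivity) (by positivity)
  have hY2 : Y ^ ε ≤ 2 ^ ((1 + a) * ε) * kk ^ ((1 + a) * ε) *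
      (β ^ ε * ps ^ ε * ((n ^ 2) ^ ε * l ^ ((1 - a) * ε))) := by
    refine (Real.rpow_le_rpow hY0 hY1 hε.le).trans (le_of_eq ?_)
    rw [Real.mul_rpow (by positivity) (by positivity), ← Real.rpow_mul (by positivity),
      Real.mul_rpow two_pos.le hkk.le, Real.mul_rpow (by positivity) (by positivity),
      Real.mul_rpow hβ0.le hps0.le, Real.mul_rpow hn2.le (by positivity), ← Real.rpow_mul hl.le]
  have hβn : β ^ a * β ^ b * β ^ ε * ((n ^ 2)⁻¹ ^ (1 + ε) * (n ^ 2) ^ ε) ≤ 9 := by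
    have e1 : (n ^ 2)⁻¹ ^ (1 + ε) * (n ^ 2) ^ ε = (n ^ 2)⁻¹ := by
      rw [Real.inv_rpow hn2.le, Real.rpow_add hn2, Real.rpow_one]
      have := Real.rpow_pos_of_pos hn2 ε
      field_simp
    have e2 : β ^ a * β ^ b * β ^ ε ≤ 9 * n ^ 2 := by
      rw [← Real.rpow_add hβ0, ← Real.rpow_add hβ0, habε]
      have hd0 : (0 : ℝ) < d := by exact_mod_cast hd
      refine (Real.rpow_le_rpow hβ0.le hβ (by positivity)).trans (le_of_eq ?_)
      rw [← Real.rpow_natCast, ← Real.rpow_mul (by positivity), mul_div_cancel₀ _ hd0.ne',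
        Real.rpow_two]
      ring
    rw [e1, ← div_eq_mul_inv, div_le_iff₀ hn2]
    exact e2
  -- The weight norm enters once in the step and to the power `ε` through the initial mass; `qs`
  -- enters once and is rounded up.
  have hpq : ps * ps ^ ε * qs ≤ (ps * qs) ^ (1 + ε) := by
    rw [Real.mul_rpow hps0.le hqs0.le, Real.rpow_add hps0, Real.rpow_one]
    refine mul_le_mul_of_nonneg_left ?_ (by positivity)
    simpa using Real.rpow_le_rpow_of_exponent_le hqs (show (1 : ℝ) ≤ 1 + ε by linarith)
  set Cs : ℝ := (2 * d * (1 + ρ * (1 - b))) ^ 2 with hCs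
  have hCs0 : 0 ≤ Cs := sq_nonneg _
  set t2 : ℝ := ((2 : ℝ) ^ Γ) ^ ε⁻¹ with ht2
  have ht20 : 0 ≤ t2 := by positivity
  have e4 : (4 * (n ^ 2)⁻¹) ^ (1 + ε) = 4 ^ (1 + ε) * (n ^ 2)⁻¹ ^ (1 + ε) :=
    Real.mul_rpow (by norm_num) (by positivity)
  have e5 : (lam / 4) ^ (-Γ) = lam ^ (-Γ) * 4 ^ Γ := by
    rw [Real.div_rpow hlam.le (by norm_num), Real.rpow_neg (x := 4) (by norm_num), div_inv_eq_mul]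
  have hPQ : P * Q ≤ β ^ a * ps * (β ^ b * qs) := mul_le_mul hP hQ hQ0 (by positivity)
  rw [e4, e5]
  calc kk ^ (-(2 * ε)) * (Cs * P * Q * (4 ^ (1 + ε) * (n ^ 2)⁻¹ ^ (1 + ε))) *
        (lam ^ (-Γ) * 4 ^ Γ) * t2 * Y ^ ε
      = (kk ^ (-(2 * ε)) * (Cs * (4 ^ (1 + ε) * (n ^ 2)⁻¹ ^ (1 + ε))) *
        (lam ^ (-Γ) * 4 ^ Γ) * t2) * ((P * Q) * Y ^ ε) := by ring
    _ ≤ (kk ^ (-(2 * ε)) * (Cs * (4 ^ (1 + ε) * (n ^ 2)⁻¹ ^ (1 + ε))) *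
        (lam ^ (-Γ) * 4 ^ Γ) * t2) * ((β ^ a * ps * (β ^ b * qs)) *
        (2 ^ ((1 + a) * ε) * kk ^ ((1 + a) * ε) *
          (β ^ ε * ps ^ ε * ((n ^ 2) ^ ε * l ^ ((1 - a) * ε))))) := by
        refine mul_le_mul_of_nonneg_left ?_ (by positivity)
        exact mul_le_mul hPQ hY2 (by positivity) (by positivity)
    _ = (kk ^ (-(2 * ε)) * kk ^ ((1 + a) * ε)) * (Cs * 4 ^ (1 + ε) * 4 ^ Γ * t2 *
          2 ^ ((1 + a) * ε) * lam ^ (-Γ) * l ^ ((1 - a) * ε)) *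
        ((β ^ a * β ^ b * β ^ ε * ((n ^ 2)⁻¹ ^ (1 + ε) * (n ^ 2) ^ ε)) *
          (ps * ps ^ ε * qs)) := by ring
    _ ≤ (kk ^ (-(2 * ε)) * kk ^ ((1 + a) * ε)) * (Cs * 4 ^ (1 + ε) * 4 ^ Γ * t2 *
          2 ^ ((1 + a) * ε) * lam ^ (-Γ) * l ^ ((1 - a) * ε)) * (9 * (ps * qs) ^ (1 + ε)) := by
        refine mul_le_mul_of_nonneg_left ?_ (by positivity)
        exact mul_le_mul hβn hpq (by positivity) (by norm_num)
    _ = (kk ^ (-(2 * ε)) * kk ^ ((1 + a) * ε)) * (iterConst d a b ρ ε Γ * (ps * qs) ^ (1 + ε) *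
          lam ^ (-Γ) * l ^ ((1 - a) * ε)) := by rw [iterConst]; ring
    _ ≤ (kk ^ (-(2 * ε)) * kk ^ ((1 + a) * ε)) * kk ^ ((1 - a) * ε) :=
        mul_le_mul_of_nonneg_left hlevel (by positivity)
    _ = 1 := by
        rw [← Real.rpow_add hkk, ← Real.rpow_add hkk,
          show -(2 * ε) + (1 + a) * ε + (1 - a) * ε = 0 by ring, Real.rpow_zero]

end Constants

/-! ### Initial mass in terms of the `L¹` norm -/

section MaximalInequality

variable {d : ℕ} {c : (Fin d → ℤ) → (Fin d → ℤ) → ℝ} {m : ℝ} {W N : (Fin d → ℤ) → ℝ}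

theorem IsBoundedCaloric.continuousOn_sum_abs {n : ℕ} {U : ℝ} {u : ℝ → (Fin d → ℤ) → ℝ}
    (hu : IsBoundedCaloric c n U u) {r T : ℝ} (hr : r ≤ n) (hT : -(n : ℝ) ^ 2 < T) :
    ContinuousOn (fun t => ∑ x ∈ ball d r, |u t x|) (Icc T 0) :=
  continuousOn_finsetSum _ fun x hx =>
    ((hu.cont x (ball_mono hr hx)).mono fun _ ht => ⟨hT.trans_le ht.1, ht.2⟩).abs

/-- A concave power lies below its tangent at `z`. Used at each time with `z` the expected size `L`
of the spatial sum, it takes the place of Jensen's inequality in time. -/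
theorem rpow_le_of_pos {y z s : ℝ} (hy : 0 ≤ y) (hz : 0 < z) (hs : 0 < s) (hs1 : s < 1) :
    y ^ s ≤ z ^ s * ((1 - s) + s * (y / z)) := by
  have h1 := Real.geom_mean_le_arith_mean2_weighted (w₁ := 1 - s) (w₂ := s) (p₁ := 1) (p₂ := y / z)
    (by linarith) hs.le zero_le_one (by positivity) (by ring)
  rw [Real.one_rpow, one_mul, mul_one, Real.div_rpow hy hz.le,
    div_le_iff₀ (Real.rpow_pos_of_pos hz s)] at h1
  linarith

/-- Interpolation of the weighted `L²` mass between the supremum and the `L¹` norm. -/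
theorem IsDominated.mass_zero_le (h : IsDominated c m W N) {n : ℕ} {U : ℝ}
    {u : ℝ → (Fin d → ℤ) → ℝ} (hu : IsBoundedCaloric c n U u) {a r T S L : ℝ} (ha : 0 < a)
    (ha1 : a < 1) (hr : r ≤ n) (hT : -(n : ℝ) ^ 2 < T) (hT0 : T ≤ 0) (hS0 : 0 ≤ S)
    (hS : ∀ t ∈ Icc T 0, ∀ x ∈ ball d r, |u t x| ≤ S) (hL : 0 < L)
    (hint : ∫ t in T..0, ∑ x ∈ ball d r, |u t x| ≤ (n : ℝ) ^ 2 * L) :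
    mass W u 0 r T ≤
      S ^ (1 + a) * ((∑ x ∈ ball d r, W x ^ a⁻¹) ^ a * ((n : ℝ) ^ 2 * L ^ (1 - a))) := by
  have hn0 : (0 : ℝ) < (n : ℝ) ^ 2 := by
    have : (1 : ℝ) ≤ n := by exact_mod_cast hu.one_le
    positivity
  set P := (∑ x ∈ ball d r, W x ^ a⁻¹) ^ a with hP
  have hP0 : 0 ≤ P := Real.rpow_nonneg (h.sum_left_rpow_nonneg _ _) _
  have hSa : 0 ≤ S ^ (1 + a) := Real.rpow_nonneg hS0 _
  have hcont := hu.continuousOn_sum_abs hr hT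
  have hpt : ∀ t ∈ Icc T 0, ∑ x ∈ ball d r, W x * max (u t x - 0) 0 ^ 2 ≤
      S ^ (1 + a) * (P * (L ^ (1 - a) * (a + (1 - a) * (L⁻¹ * ∑ x ∈ ball d r, |u t x|)))) := by
    intro t ht
    have h1 : ∑ x ∈ ball d r, W x * max (u t x - 0) 0 ^ 2 ≤
        S ^ (1 + a) * ∑ x ∈ ball d r, (W x ^ a⁻¹) ^ a * |u t x| ^ (1 - a) := by
      rw [Finset.mul_sum]
      refine Finset.sum_le_sum fun x hx => ?_
      rw [Real.rpow_inv_rpow (h.left_nonneg x) ha.ne', sub_zero]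
      have e1 : max (u t x) 0 ^ 2 ≤ |u t x| ^ (1 + a) * |u t x| ^ (1 - a) := by
        rw [← Real.rpow_add_of_nonneg (abs_nonneg _) (by linarith) (by linarith),
          show 1 + a + (1 - a) = 2 by ring, Real.rpow_two]
        exact pow_le_pow_left₀ (le_max_right _ _) (max_le (le_abs_self _) (abs_nonneg _)) 2
      have e2 : |u t x| ^ (1 + a) ≤ S ^ (1 + a) :=
        Real.rpow_le_rpow (abs_nonneg _) (hS t ht x hx) (by linarith)
      have e3 := e1.trans (mul_le_mul_of_nonneg_right e2 (Real.rpow_nonneg (abs_nonneg _) _))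
      have e4 := mul_le_mul_of_nonneg_left e3 (h.left_nonneg x)
      linarith
    refine h1.trans (mul_le_mul_of_nonneg_left ?_ hSa)
    refine (sum_rpow_mul_rpow_le (ball d r) ha ha1
      (fun x _ => Real.rpow_nonneg (h.left_nonneg x) _) (fun x _ => abs_nonneg (u t x))).trans
      (mul_le_mul_of_nonneg_left ?_ hP0)
    have := rpow_le_of_pos (s := 1 - a) (z := L) (Finset.sum_nonneg fun x (_ : x ∈ ball d r) =>
      abs_nonneg (u t x)) hL (by linarith) (by linarith)
    rwa [sub_sub_cancel, div_eq_inv_mul] at this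
  have hL1 : 0 ≤ L ^ (1 - a) := Real.rpow_nonneg hL.le _
  calc mass W u 0 r T
      ≤ ∫ t in T..0, S ^ (1 + a) * (P * (L ^ (1 - a) *
          (a + (1 - a) * (L⁻¹ * ∑ x ∈ ball d r, |u t x|)))) := by
        refine intervalIntegral.integral_mono_on hT0
          ((hu.continuousOn_mass_integrand 0 hr hT).intervalIntegrable_of_Icc hT0)
          (ContinuousOn.intervalIntegrable_of_Icc hT0 ?_) hpt
        fun_prop
    _ = S ^ (1 + a) * (P * (L ^ (1 - a) *
          (a * (-T) + (1 - a) * (L⁻¹ * ∫ t in T..0, ∑ x ∈ ball d r, |u t x|)))) := by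
        have hi : IntervalIntegrable (fun t => (1 - a) * (L⁻¹ * ∑ x ∈ ball d r, |u t x|))
            volume T 0 := ContinuousOn.intervalIntegrable_of_Icc hT0 (by fun_prop)
        rw [intervalIntegral.integral_const_mul, intervalIntegral.integral_const_mul,
          intervalIntegral.integral_const_mul, intervalIntegral.integral_add (by simp) hi,
          intervalIntegral.integral_const_mul, intervalIntegral.integral_const_mul,
          intervalIntegral.integral_const]
        simp [mul_comm]
    _ ≤ S ^ (1 + a) * (P * (L ^ (1 - a) * (n : ℝ) ^ 2)) := by
        refine mul_le_mul_of_nonneg_left (mul_le_mul_of_nonneg_left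
          (mul_le_mul_of_nonneg_left ?_ hL1) hP0) hSa
        have e1 : L⁻¹ * ∫ t in T..0, ∑ x ∈ ball d r, |u t x| ≤ (n : ℝ) ^ 2 := by
          rw [← div_eq_inv_mul, div_le_iff₀ hL]
          exact hint
        have e2 := mul_le_mul_of_nonneg_left e1 (show 0 ≤ 1 - a by linarith)
        have e3 := mul_le_mul_of_nonneg_left (show -T ≤ (n : ℝ) ^ 2 by linarith) ha.le
        linarith
    _ = _ := by ring

end MaximalInequality

/-! ### The deterministic maximal inequality -/

section MaximalInequality

variable {d : ℕ} {c : (Fin d → ℤ) → (Fin d → ℤ) → ℝ} {m : ℝ} {W N : (Fin d → ℤ) → ℝ}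

theorem iterConst_pos {d : ℕ} (hd : 0 < d) {a b ρ ε Γ : ℝ} (hb1 : b < 1) (hρ : 0 < ρ) :
    0 < iterConst d a b ρ ε Γ := by
  have hd0 : (0 : ℝ) < d := by exact_mod_cast hd
  have : 0 < ρ * (1 - b) := mul_pos hρ (by linarith)
  unfold iterConst
  positivity

/-- The iteration applied with an explicit level. It is one-sided: the conclusion bounds `u` from
above, although the hypotheses involve `|u|`. -/
theorem IsDominated.le_of_bounded (h : IsDominated c m W N) (hd : 2 ≤ d) {a b ρ ε : ℝ}
    (ha : 0 < a) (hb : 0 < b) (hb1 : b < 1) (hρ : 0 < ρ) (hρb : ρ⁻¹ = 1 - 2 / d + b)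
    (hε : 0 < ε) (hsum : a + ρ⁻¹ + ε = 1) {n : ℕ} {U : ℝ} {u : ℝ → (Fin d → ℤ) → ℝ}
    (hu : IsBoundedCaloric c n U u) {θ θ₁ lam β ps qs l S : ℝ} (hθ₁ : 0 < θ₁) (hlam : 0 < lam)
    (hθ₂ : θ₁ + lam ≤ θ) (hθ : θ < 1) (hβ0 : 0 < β) (hβ : β ≤ (3 * n) ^ d)
    (hP : (∑ x ∈ ball d (θ * n), W x ^ a⁻¹) ^ a ≤ β ^ a * ps)
    (hQ : (∑ x ∈ ball d (θ * n), N x ^ b⁻¹) ^ b ≤ β ^ b * qs)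
    (hps : 1 ≤ ps) (hqs : 1 ≤ qs) (hl : 0 < l)
    (hint : ∫ t in (-(θ * (n : ℝ) ^ 2))..0, ∑ x ∈ ball d (θ * n), |u t x| ≤
      (n : ℝ) ^ 2 * (β * l)) (hS0 : 0 ≤ S)
    (hS : ∀ t ∈ Icc (-((θ₁ + lam) * (n : ℝ) ^ 2)) 0, ∀ x ∈ ball d ((θ₁ + lam) * n), |u t x| ≤ S) :
    ∀ t ∈ Icc (-(θ₁ * (n : ℝ) ^ 2)) 0, ∀ x ∈ ball d (θ₁ * n), u t x ≤
      U * (n : ℝ) ^ (-(m - 2)) + S / 2 +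
        (iterConst d a b ρ ε ((m + 3) * (1 + ε)) * (ps * qs) ^ (1 + ε) *
          lam ^ (-((m + 3) * (1 + ε)))) ^ ((1 - a) * ε)⁻¹ * l := by
  have hn1 : (1 : ℝ) ≤ n := by exact_mod_cast hu.one_le
  have hn0 : (0 : ℝ) < n := by linarith
  have hn2 : (0 : ℝ) < (n : ℝ) ^ 2 := by positivity
  have ha1 : a < 1 := by have := inv_pos.2 hρ; linarith
  set Γ := (m + 3) * (1 + ε) with hΓ
  set X := iterConst d a b ρ ε Γ * (ps * qs) ^ (1 + ε) * lam ^ (-Γ) with hX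
  have hX0 : 0 < X := by
    have := iterConst_pos (d := d) (by omega) (a := a) (ε := ε) (Γ := Γ) hb1 hρ
    have hps0 : 0 < ps := by linarith
    have hqs0 : 0 < qs := by linarith
    positivity
  have hae : 0 < (1 - a) * ε := mul_pos (by linarith) hε
  have hU : 0 ≤ U := (abs_nonneg _).trans (hu.bound 0 ⟨by linarith, le_rfl⟩ 0)
  set hh := U * (n : ℝ) ^ (-(m - 2)) with hhh
  have hh0 : 0 ≤ hh := by positivity
  -- The first summand makes the jump tail admissible, the second ensures `S ≤ 2 kk`, and the third
  -- solves the smallness condition for the level.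
  set kk := hh + S / 2 + X ^ ((1 - a) * ε)⁻¹ * l with hkkdef
  have hXl : 0 < X ^ ((1 - a) * ε)⁻¹ * l := by positivity
  have hkk : 0 < kk := by linarith
  have hθ₂n : (θ₁ + lam) * n ≤ θ * n := mul_le_mul_of_nonneg_right hθ₂ hn0.le
  have hθ₂n2 : (θ₁ + lam) * (n : ℝ) ^ 2 ≤ θ * (n : ℝ) ^ 2 :=
    mul_le_mul_of_nonneg_right hθ₂ hn2.le
  have hθn : θ * n ≤ n := mul_le_of_le_one_left hn0.le hθ.le
  have hθn2 : θ * (n : ℝ) ^ 2 < (n : ℝ) ^ 2 := by nlinarith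
  have h12 : 0 < (θ₁ + lam) * (n : ℝ) ^ 2 := by positivity
  have hUk : U ≤ kk * (n : ℝ) ^ (m - 2) := by
    calc U = hh * (n : ℝ) ^ (m - 2) := by
          rw [hhh, mul_assoc, ← Real.rpow_add hn0, neg_add_cancel, Real.rpow_zero, mul_one]
      _ ≤ kk * (n : ℝ) ^ (m - 2) :=
          mul_le_mul_of_nonneg_right (by linarith) (Real.rpow_nonneg hn0.le _)
  refine h.le_of_small_mass hd ha hb hb1 hρ hρb hε hsum hu hθ₁ hlam (hθ₂.trans_lt hθ) hkk hUk ?_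
  have hWmono : (∑ x ∈ ball d ((θ₁ + lam) * n), W x ^ a⁻¹) ^ a ≤
      (∑ x ∈ ball d (θ * n), W x ^ a⁻¹) ^ a :=
    Real.rpow_le_rpow (h.sum_left_rpow_nonneg _ _) (Finset.sum_le_sum_of_subset_of_nonneg
      (ball_mono hθ₂n) fun x _ _ => Real.rpow_nonneg (h.left_nonneg x) _) ha.le
  have hNmono : (∑ x ∈ ball d ((θ₁ + lam) * n), N x ^ b⁻¹) ^ b ≤
      (∑ x ∈ ball d (θ * n), N x ^ b⁻¹) ^ b :=
    Real.rpow_le_rpow (h.sum_right_rpow_nonneg _ _) (Finset.sum_le_sum_of_subset_of_nonneg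
      (ball_mono hθ₂n) fun x _ _ => Real.rpow_nonneg (h.right_nonneg x) _) hb.le
  have hint' : ∫ t in (-((θ₁ + lam) * (n : ℝ) ^ 2))..0, ∑ x ∈ ball d ((θ₁ + lam) * n), |u t x| ≤
      (n : ℝ) ^ 2 * (β * l) := by
    refine le_trans ?_ hint
    have hc := hu.continuousOn_sum_abs hθn (neg_lt_neg hθn2)
    have hc' := hu.continuousOn_sum_abs (r := (θ₁ + lam) * n) (hθ₂n.trans hθn)
      (neg_lt_neg (hθ₂n2.trans_lt hθn2))
    have hsub := Icc_subset_Icc (neg_le_neg hθ₂n2) (le_refl (0 : ℝ))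
    calc ∫ t in (-((θ₁ + lam) * (n : ℝ) ^ 2))..0, ∑ x ∈ ball d ((θ₁ + lam) * n), |u t x|
        ≤ ∫ t in (-((θ₁ + lam) * (n : ℝ) ^ 2))..0, ∑ x ∈ ball d (θ * n), |u t x| :=
          intervalIntegral.integral_mono_on (by linarith)
            (hc'.intervalIntegrable_of_Icc (by linarith))
            ((hc.mono hsub).intervalIntegrable_of_Icc (by linarith))
            fun t _ => Finset.sum_le_sum_of_subset_of_nonneg (ball_mono hθ₂n)
              fun x _ _ => abs_nonneg _
      _ ≤ _ := intervalIntegral.integral_mono_interval (neg_le_neg hθ₂n2) (by linarith) le_rfl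
          (Filter.Eventually.of_forall fun t => Finset.sum_nonneg fun x _ => abs_nonneg _)
          (hc.intervalIntegrable_of_Icc (by linarith))
  refine smallness_of_level_large (d := d) (n := n) (by omega) ha ha1 hε (by linarith) hn0 hβ0 hβ
    (Real.rpow_nonneg (h.sum_left_rpow_nonneg _ _) _)
    (Real.rpow_nonneg (h.sum_right_rpow_nonneg _ _) _)
    (hWmono.trans hP) (hNmono.trans hQ) hps hqs hkk hlam hS0 (by linarith) hl
    (h.mass_nonneg u (by linarith))
    (h.mass_zero_le hu ha ha1 (hθ₂n.trans hθn) (by linarith) (by linarith) hS0 hS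
      (mul_pos hβ0 hl) hint') ?_
  calc X * l ^ ((1 - a) * ε) = (X ^ ((1 - a) * ε)⁻¹ * l) ^ ((1 - a) * ε) := by
        rw [Real.mul_rpow (by positivity) hl.le, Real.rpow_inv_rpow hX0.le hae.ne']
    _ ≤ kk ^ ((1 - a) * ε) := Real.rpow_le_rpow hXl.le (by linarith) hae.le

/-- The constant in the maximal inequality. -/
noncomputable def maxConst (d : ℕ) (m a b ρ ε : ℝ) : ℝ :=
  2 + 4 * (3 * ((m + 3) * ((1 + ε) * ((1 - a) * ε)⁻¹))) ^ ((m + 3) * ((1 + ε) * ((1 - a) * ε)⁻¹)) *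
    iterConst d a b ρ ε ((m + 3) * (1 + ε)) ^ ((1 - a) * ε)⁻¹

/-- The deterministic maximal inequality. -/
theorem IsDominated.maximal_inequality (h : IsDominated c m W N) (hd : 2 ≤ d) {a b ρ ε : ℝ}
    (ha : 0 < a) (hb : 0 < b) (hb1 : b < 1) (hρ : 0 < ρ) (hρb : ρ⁻¹ = 1 - 2 / d + b)
    (hε : 0 < ε) (hsum : a + ρ⁻¹ + ε = 1) {n : ℕ} {U : ℝ} {u : ℝ → (Fin d → ℤ) → ℝ}
    (hu : IsBoundedCaloric c n U u) {θ θ' β ps qs l : ℝ} (hθ' : 0 < θ') (hθθ : θ' < θ)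
    (hθ : θ < 1) (hβ0 : 0 < β) (hβ : β ≤ (3 * n) ^ d)
    (hP : (∑ x ∈ ball d (θ * n), W x ^ a⁻¹) ^ a ≤ β ^ a * ps)
    (hQ : (∑ x ∈ ball d (θ * n), N x ^ b⁻¹) ^ b ≤ β ^ b * qs)
    (hps : 1 ≤ ps) (hqs : 1 ≤ qs) (hl : 0 < l)
    (hint : ∫ t in (-(θ * (n : ℝ) ^ 2))..0, ∑ x ∈ ball d (θ * n), |u t x| ≤
      (n : ℝ) ^ 2 * (β * l)) :
    ∀ t ∈ Icc (-(θ' * (n : ℝ) ^ 2)) 0, ∀ x ∈ ball d (θ' * n), |u t x| ≤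
      maxConst d m a b ρ ε * ((n : ℝ) ^ (-(m - 2)) * U +
        (ps * qs / (θ - θ') ^ (m + 3)) ^ ((1 + ε) * ((1 - a) * ε)⁻¹) * l) := by
  have hn1 : (1 : ℝ) ≤ n := by exact_mod_cast hu.one_le
  have hn0 : (0 : ℝ) < n := by linarith
  have hn2 : (0 : ℝ) < (n : ℝ) ^ 2 := by positivity
  have ha1 : a < 1 := by have := inv_pos.2 hρ; linarith
  have hm := h.two_le
  have hε1 : ε < 1 := by have := inv_pos.2 hρ; linarith
  have hae : 0 < (1 - a) * ε := mul_pos (by linarith) hε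
  have hU : 0 ≤ U := (abs_nonneg _).trans (hu.bound 0 ⟨by linarith, le_rfl⟩ 0)
  have hpq : 0 < ps * qs := mul_pos (by linarith) (by linarith)
  set ϖ := ((1 - a) * ε)⁻¹ with hϖ
  have hϖ1 : 1 ≤ ϖ := (one_le_inv₀ hae).2 (by nlinarith)
  set Γ := (m + 3) * (1 + ε) with hΓ
  set κ₀ := (1 + ε) * ϖ with hκ₀
  have hκ₀1 : 1 ≤ κ₀ := by nlinarith
  set κ := (m + 3) * κ₀ with hκ
  have hκ1 : 1 ≤ κ := by nlinarith
  set D := iterConst d a b ρ ε Γ with hD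
  have hD0 : 0 < D := iterConst_pos (by omega) hb1 hρ
  set A := D ^ ϖ * (ps * qs) ^ κ₀ * l with hA
  have hA0 : 0 ≤ A := by positivity
  have hΔ : 0 < θ - θ' := by linarith
  have hkey := le_of_half_absorption (θ₀ := θ) (θ₁ := θ') (hh := U * (n : ℝ) ^ (-(m - 2)))
    (A := A) (κ := κ) (K := U)
    (bd := fun s S => ∀ t ∈ Icc (-(s * (n : ℝ) ^ 2)) 0, ∀ x ∈ ball d (s * n), |u t x| ≤ S)
    hκ1 hA0 (by positivity) hU
    (fun _ _ _ hss hb t ht x hx => (hb t ht x hx).trans hss)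
    (fun _ _ hb t ht x hx => le_of_forall_pos_le_add fun e he => hb e he t ht x hx)
    (fun s _ hs t ht x _ => hu.bound t ⟨by nlinarith [ht.1], ht.2⟩ x)
    (fun s lam S hs hlam hsl hS0 hS t ht x hx => by
      have hs0 : 0 < s := by linarith
      have hX : (D * (ps * qs) ^ (1 + ε) * lam ^ (-Γ)) ^ ϖ * l = A * lam ^ (-κ) := by
        rw [Real.mul_rpow (by positivity) (by positivity), Real.mul_rpow hD0.le (by positivity),
          ← Real.rpow_mul hpq.le, ← Real.rpow_mul hlam.le, hA, hκ, hκ₀, hΓ]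
        rw [show -((m + 3) * (1 + ε)) * ϖ = -((m + 3) * ((1 + ε) * ϖ)) by ring]
        ring
      have hneg : ∫ t in (-(θ * (n : ℝ) ^ 2))..0, ∑ x ∈ ball d (θ * n), |-u t x| ≤
          (n : ℝ) ^ 2 * (β * l) := by simpa only [abs_neg] using hint
      -- Bounds for `u` and for `-u` with the same level combine to one for `|u|`, which is what the
      -- absorption iterates.
      have h1 := h.le_of_bounded hd ha hb hb1 hρ hρb hε hsum hu hs0 hlam hsl.le hθ hβ0 hβ hP hQ
        hps hqs hl hint hS0 hS t ht x hx
      have h2 := h.le_of_bounded hd ha hb hb1 hρ hρb hε hsum hu.neg hs0 hlam hsl.le hθ hβ0 hβ hP hQ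
        hps hqs hl hneg hS0 (fun t ht x hx => by rw [abs_neg]; exact hS t ht x hx) t ht x hx
      rw [← hX]
      exact abs_le.2 ⟨by linarith, h1⟩) hθθ
  intro t ht x hx
  refine (hkey t ht x hx).trans ?_
  have hZ : (ps * qs / (θ - θ') ^ (m + 3)) ^ κ₀ = (ps * qs) ^ κ₀ * (θ - θ') ^ (-κ) := by
    rw [Real.div_rpow hpq.le (by positivity), ← Real.rpow_mul hΔ.le, Real.rpow_neg hΔ.le,
      div_eq_mul_inv]
  rw [hZ, maxConst, ← hϖ, ← hκ₀, ← hκ, ← hΓ, ← hD, hA]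
  set R := (ps * qs) ^ κ₀ * (θ - θ') ^ (-κ) * l with hR
  have hR0 : 0 ≤ R := by positivity
  have h4 : 0 ≤ 4 * (3 * κ) ^ κ * D ^ ϖ := by positivity
  have hUn : 0 ≤ U * (n : ℝ) ^ (-(m - 2)) := by positivity
  have h5 := mul_nonneg h4 hUn
  calc 2 * (U * (n : ℝ) ^ (-(m - 2))) +
        4 * (3 * κ) ^ κ * (D ^ ϖ * (ps * qs) ^ κ₀ * l) * (θ - θ') ^ (-κ)
      = 2 * (U * (n : ℝ) ^ (-(m - 2))) + 4 * (3 * κ) ^ κ * D ^ ϖ * R := by rw [hR]; ring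
    _ ≤ (2 + 4 * (3 * κ) ^ κ * D ^ ϖ) * (U * (n : ℝ) ^ (-(m - 2)) + R) := by
        rw [add_mul, mul_add, mul_add]
        linarith
    _ = _ := by ring

end MaximalInequality

/-! ### Averaged norms -/

section Averages

variable {d : ℕ}

theorem memLp_ennreal_ae_ne_top {Ω : Type*} [MeasurableSpace Ω] {P : Measure Ω} {f : Ω → ℝ≥0∞}
    {p : ℝ≥0∞} (hp : p ≠ 0) (hf : MemLp f p P) : ∀ᵐ ω ∂P, f ω ≠ ∞ := by
  rcases eq_or_ne p ∞ with rfl | hp'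
  · have h := hf.2
    rw [eLpNorm_exponent_top] at h
    filter_upwards [ae_le_eLpNormEssSup (f := f) (μ := P)] with ω hω
    exact (hω.trans_lt h).ne
  · have h1 := lintegral_rpow_enorm_lt_top_of_eLpNorm_lt_top hp hp' hf.2
    have h2 := ae_lt_top' (hf.aemeasurable.enorm.pow_const p.toReal) h1.ne
    filter_upwards [h2] with ω hω htop
    rw [enorm_eq_self, htop, ENNReal.top_rpow_of_pos (ENNReal.toReal_pos hp hp')] at hω
    exact hω.ne rfl

theorem avgNorm_one (A : Finset (Fin d → ℤ)) (f : (Fin d → ℤ) → ℝ) :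
    avgNorm 1 A f = (A.card : ℝ)⁻¹ * ∑ x ∈ A, |f x| := by
  simp [avgNorm]

/-- Averaged norms increase with the exponent. -/
theorem rpow_average_le_avgNorm {A : Finset (Fin d → ℤ)} (hA : A.Nonempty)
    {f : (Fin d → ℤ) → ℝ} (hf : ∀ x, 0 ≤ f x) {p : ℝ≥0∞} (hp : p ≠ 0) {a : ℝ} (ha : 0 < a)
    (hpa : (p⁻¹).toReal ≤ a) :
    ((A.card : ℝ)⁻¹ * ∑ x ∈ A, f x ^ a⁻¹) ^ a ≤ avgNorm p A f := by
  have hcard : (0 : ℝ) < A.card := by exact_mod_cast hA.card_pos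
  have hS0 : 0 ≤ ∑ x ∈ A, f x ^ a⁻¹ := Finset.sum_nonneg fun x _ => Real.rpow_nonneg (hf x) _
  rcases eq_or_ne p ∞ with rfl | hp'
  · rw [avgNorm, if_pos rfl]
    set M := ⨆ x : A, |f x| with hM
    have hle : ∀ x ∈ A, f x ≤ M := fun x hx =>
      (le_abs_self _).trans (le_ciSup (f := fun x : A => |f x|) (Set.finite_range _).bddAbove ⟨x, hx⟩)
    obtain ⟨x₀, hx₀⟩ := hA
    have hM0 : 0 ≤ M := (hf x₀).trans (hle x₀ hx₀)
    have h1 : (A.card : ℝ)⁻¹ * ∑ x ∈ A, f x ^ a⁻¹ ≤ M ^ a⁻¹ := by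
      rw [← div_eq_inv_mul, div_le_iff₀ hcard]
      refine (Finset.sum_le_card_nsmul _ _ _ fun x hx =>
        Real.rpow_le_rpow (hf x) (hle x hx) (inv_nonneg.2 ha.le)).trans (le_of_eq ?_)
      rw [nsmul_eq_mul, mul_comm]
    calc _ ≤ (M ^ a⁻¹) ^ a := Real.rpow_le_rpow (by positivity) h1 ha.le
      _ = M := Real.rpow_inv_rpow hM0 ha.ne'
  · rw [avgNorm, if_neg hp']
    have hr : 0 < p.toReal := ENNReal.toReal_pos hp hp'
    set r := p.toReal with hrdef
    rw [ENNReal.toReal_inv, ← hrdef] at hpa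
    have hra : 1 ≤ r * a := by
      have := mul_le_mul_of_nonneg_left hpa hr.le
      rwa [mul_inv_cancel₀ hr.ne'] at this
    have h1 := Real.rpow_arith_mean_le_arith_mean_rpow A (fun _ => (A.card : ℝ)⁻¹)
      (fun x => f x ^ a⁻¹) (fun _ _ => by positivity)
      (by rw [Finset.sum_const, nsmul_eq_mul, mul_inv_cancel₀ hcard.ne'])
      (fun x _ => Real.rpow_nonneg (hf x) _) hra
    have h2 : ∀ x, (f x ^ a⁻¹) ^ (r * a) = |f x| ^ r := fun x => by
      rw [abs_of_nonneg (hf x), ← Real.rpow_mul (hf x)]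
      congr 1
      field_simp
    simp_rw [h2, ← Finset.mul_sum] at h1
    have h3 := Real.rpow_le_rpow (by positivity) h1 (show 0 ≤ 1 / r by positivity)
    rwa [← Real.rpow_mul (by positivity), show r * a * (1 / r) = a by field_simp] at h3

theorem one_le_avgNorm {A : Finset (Fin d → ℤ)} (hA : A.Nonempty) {f : (Fin d → ℤ) → ℝ}
    (hf : ∀ x, 1 ≤ f x) {p : ℝ≥0∞} (hp : p ≠ 0) : 1 ≤ avgNorm p A f := by
  have hcard : (0 : ℝ) < A.card := by exact_mod_cast hA.card_pos
  have ha : 0 < (p⁻¹).toReal + 1 := by positivity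
  refine le_trans ?_ (rpow_average_le_avgNorm hA (fun x => zero_le_one.trans (hf x)) hp ha
    (by linarith))
  refine Real.one_le_rpow ?_ ha.le
  rw [← div_eq_inv_mul, one_le_div hcard]
  calc (A.card : ℝ) = ∑ x ∈ A, 1 := by simp
    _ ≤ _ := Finset.sum_le_sum fun x _ => Real.one_le_rpow (hf x) (inv_nonneg.2 ha.le)

theorem rpow_sum_le_card_rpow_mul_avgNorm {A : Finset (Fin d → ℤ)} (hA : A.Nonempty)
    {f : (Fin d → ℤ) → ℝ} (hf : ∀ x, 0 ≤ f x) {p : ℝ≥0∞} (hp : p ≠ 0) {a : ℝ} (ha : 0 < a)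
    (hpa : (p⁻¹).toReal ≤ a) :
    (∑ x ∈ A, f x ^ a⁻¹) ^ a ≤ (A.card : ℝ) ^ a * avgNorm p A f := by
  have hcard : (0 : ℝ) < A.card := by exact_mod_cast hA.card_pos
  have hS0 : 0 ≤ ∑ x ∈ A, f x ^ a⁻¹ := Finset.sum_nonneg fun x _ => Real.rpow_nonneg (hf x) _
  refine le_trans (le_of_eq ?_) (mul_le_mul_of_nonneg_left
    (rpow_average_le_avgNorm hA hf hp ha hpa) (Real.rpow_nonneg hcard.le a))
  rw [← Real.mul_rpow hcard.le (by positivity), mul_inv_cancel_left₀ hcard.ne']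

end Averages

/-! ### Caloric functions -/

section Caloric

variable {d : ℕ}

/-- Restriction to the smaller cylinder. The one-sided derivative becomes two-sided at times before
0; at the final time only continuity is kept, which suffices for the energy estimate. -/
theorem IsCaloric.isBoundedCaloric {Ω : Type*}
    {C : (Fin d → ℤ) → (Fin d → ℤ) → Ω → ℝ≥0} {ω : Ω} {n : ℕ} (hn : 1 ≤ n) {u : ℝ → (Fin d → ℤ) → ℝ}
    (hb : ∃ K : ℝ, ∀ t ∈ Set.Ioc (-(4 * (n : ℝ) ^ 2)) 0, ∀ x, |u t x| ≤ K)
    (hu : IsCaloric C ω (4 * (n : ℝ) ^ 2) (2 * (n : ℝ)) u) :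
    IsBoundedCaloric (fun x y => (C x y ω : ℝ)) n (supNorm ((n : ℝ) ^ 2) u) u := by
  have hn0 : (0 : ℝ) ≤ n := Nat.cast_nonneg n
  have hn2 : (0 : ℝ) ≤ (n : ℝ) ^ 2 := by positivity
  have hsub : Ioc (-(n : ℝ) ^ 2) 0 ⊆ Ioc (-(4 * (n : ℝ) ^ 2)) 0 :=
    Ioc_subset_Ioc_left (by linarith)
  have hball : ball d n ⊆ ball d (2 * n) := ball_mono (by linarith)
  refine ⟨hn, fun t ht y => ?_, fun t ht x hx => ?_, fun x hx t ht => ?_⟩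
  · obtain ⟨K, hK⟩ := hb
    -- Boundedness of `u` is needed here: the real supremum of an unbounded set has the default
    -- value 0.
    refine le_csSup ⟨K, ?_⟩ ⟨(t, y), ⟨ht, mem_univ _⟩, rfl⟩
    rintro _ ⟨⟨s, z⟩, ⟨hs, -⟩, rfl⟩
    exact hK s (hsub hs) z
  · exact (hu t (hsub ⟨ht.1, ht.2.le⟩) x (hball hx)).hasDerivAt
      (Ioc_mem_nhds (hsub ⟨ht.1, ht.2.le⟩).1 ht.2)
  · exact (hu t (hsub ht) x (hball hx)).continuousWithinAt.mono hsub

theorem IsBoundedCaloric.exists_isGreatest {c : (Fin d → ℤ) → (Fin d → ℤ) → ℝ} {n : ℕ} {U : ℝ}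
    {u : ℝ → (Fin d → ℤ) → ℝ} (hu : IsBoundedCaloric c n U u) {s R : ℝ} (hs : 0 ≤ s)
    (hsn : s < (n : ℝ) ^ 2) (hR : 0 ≤ R) (hRn : R ≤ n) :
    ∃ z ∈ cylinder d s R,
      IsGreatest ((fun z : ℝ × (Fin d → ℤ) => |u z.1 z.2|) '' cylinder d s R) |u z.1 z.2| := by
  have hmax : ∀ x ∈ ball d R, ∃ t ∈ Icc (-s) 0, ∀ t' ∈ Icc (-s) 0, |u t' x| ≤ |u t x| :=
    fun x hx => isCompact_Icc.exists_isMaxOn ⟨0, by linarith, le_rfl⟩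
      (((hu.cont x (ball_mono hRn hx)).mono fun t ht =>
        ⟨(neg_lt_neg hsn).trans_le ht.1, ht.2⟩).abs)
  choose! T hT hTmax using hmax
  obtain ⟨x, hx, hxmax⟩ := (ball d R).exists_max_image (fun x => |u (T x) x|)
    (Finset.card_pos.1 (card_ball_pos hR))
  refine ⟨(T x, x), ⟨hT x hx, hx⟩, ⟨(T x, x), ⟨hT x hx, hx⟩, rfl⟩, ?_⟩
  rintro _ ⟨⟨t, y⟩, ⟨ht, hy⟩, rfl⟩
  exact (hTmax y hy t ht).trans (hxmax y hy)

end Caloric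

/-! ### From the random environment to deterministic bounds -/

section Environment

variable {d : ℕ} {Ω : Type*} [MeasurableSpace Ω] {P : Measure Ω} {τ : (Fin d → ℤ) → Ω → Ω}
  {C : (Fin d → ℤ) → (Fin d → ℤ) → Ω → ℝ≥0}

theorem IsConductance.apply_shift (hC : IsConductance P τ C) (x y : Fin d → ℤ) (ω : Ω) :
    C 0 (y - x) (τ x ω) = C x y ω := by
  rw [← hC.shift, zero_add, sub_add_cancel]

theorem IsConductance.muTilde_shift (hC : IsConductance P τ C) (m : ℝ) (x : Fin d → ℤ) (ω : Ω) :
    muTilde C m (τ x ω) =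
      ∑' y, ENNReal.ofReal (enorm2 (y - x) ^ m) * (C x y ω : ℝ≥0∞) := by
  rw [muTilde, ← (Equiv.subRight x).tsum_eq]
  exact tsum_congr fun y => by rw [Equiv.subRight_apply, hC.apply_shift]

/-- Covariance turns moments of the shifted environment into moments around `x`. With `1 / 0 = ∞`,
finiteness of `ν̃` forces nearest-neighbour conductances to be positive. -/
theorem IsConductance.isDominated (hC : IsConductance P τ C) {m : ℝ} (hm : 2 ≤ m) {ω : Ω}
    (hμ : ∀ x, muTilde C m (τ x ω) ≠ ∞) (hν : ∀ x, nuTilde C (τ x ω) ≠ ∞) :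
    IsDominated (fun x y => (C x y ω : ℝ)) m (fun x => max (mu τ C m x ω) 1)
      (fun x => max (nu τ C x ω) 1) := by
  have hterm : ∀ x y, (ENNReal.ofReal (enorm2 (y - x) ^ m) * (C x y ω : ℝ≥0∞)).toReal =
      enorm2 (y - x) ^ m * (C x y ω : ℝ) := fun x y => by
    rw [ENNReal.toReal_mul, ENNReal.toReal_ofReal (Real.rpow_nonneg (enorm2_nonneg _) _)]
    rfl
  have hle : ∀ x y, enorm2 (y - x) = 1 → (C x y ω : ℝ≥0∞)⁻¹ ≤ nuTilde C (τ x ω) := fun x y h => by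
    rw [← hC.apply_shift x y ω]
    exact ENNReal.le_tsum (f := fun z : {z : Fin d → ℤ // enorm2 z = 1} =>
      (C 0 z (τ x ω) : ℝ≥0∞)⁻¹) ⟨y - x, h⟩
  have hpos : ∀ x y, enorm2 (y - x) = 1 → 0 < C x y ω := fun x y h => by
    rw [pos_iff_ne_zero]
    intro h0
    have := hle x y h
    rw [h0, ENNReal.coe_zero, ENNReal.inv_zero, top_le_iff] at this
    exact hν x this
  refine ⟨hm, fun x y => NNReal.coe_nonneg _, fun x y => by rw [hC.symm], fun x => ?_, fun x => ?_,
    fun x => le_max_right _ _, fun x => le_max_right _ _,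
    fun x y h => NNReal.coe_pos.2 (hpos x y h), fun x y h => ?_⟩
  · have := ENNReal.summable_toReal (hC.muTilde_shift m x ω ▸ hμ x)
    simpa only [hterm] using this
  · refine le_max_of_le_left (le_of_eq ?_)
    rw [mu, hC.muTilde_shift, ENNReal.tsum_toReal_eq
      fun y => ENNReal.mul_ne_top ENNReal.ofReal_ne_top ENNReal.coe_ne_top]
    exact tsum_congr fun y => (hterm x y).symm
  · refine le_max_of_le_left ?_
    have := ENNReal.toReal_mono (hν x) (hle x y h)
    rwa [ENNReal.toReal_inv, ENNReal.coe_toReal] at this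

theorem IsStationaryErgodic.ae_shift (hτ : IsStationaryErgodic P τ) {p : Ω → Prop}
    (hp : ∀ᵐ ω ∂P, p ω) : ∀ᵐ ω ∂P, ∀ x, p (τ x ω) :=
  ae_all_iff.2 fun x => (hτ.stationary x).quasiMeasurePreserving.ae hp

/-- Exponents `a ≥ 1/p` and `b ≥ 1/q` that are positive and satisfy `a + b < 2/d`. -/
theorem exists_exponents {d : ℕ} (hd : 2 ≤ d) {p q : ℝ≥0∞} (hp : 1 < p)
    (hpq : (1 - 1 / (d : ℝ)) * (p⁻¹).toReal + (q⁻¹).toReal ≤ 1 / (d : ℝ)) :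
    ∃ a b : ℝ, 0 < a ∧ 0 < b ∧ (p⁻¹).toReal ≤ a ∧ (q⁻¹).toReal ≤ b ∧ a + b < 2 / d := by
  have hd0 : (0 : ℝ) < d := by positivity
  have h1 : (p⁻¹).toReal < 1 := by
    have := (ENNReal.toReal_lt_toReal (ENNReal.inv_ne_top.2 (zero_lt_one.trans hp).ne')
      ENNReal.one_ne_top).2 (ENNReal.inv_lt_one.2 hp)
    simpa using this
  have hlt : (p⁻¹).toReal + (q⁻¹).toReal < 2 / d := by
    -- Adding this strict inequality to the exponent condition gives `1/p + 1/q < 2/d`. Half of the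
    -- slack is shared between `a` and `b`, which also makes them positive when `p` or `q` is
    -- infinite.
    have h2 : 1 / (d : ℝ) * (p⁻¹).toReal < 1 / d * 1 := mul_lt_mul_of_pos_left h1 (by positivity)
    have h3 : 2 / (d : ℝ) = 1 / d + 1 / d := by ring
    linarith
  set e := 2 / (d : ℝ) - (p⁻¹).toReal - (q⁻¹).toReal with he
  have he0 : 0 < e := by linarith
  have hp0 : 0 ≤ (p⁻¹).toReal := ENNReal.toReal_nonneg
  have hq0 : 0 ≤ (q⁻¹).toReal := ENNReal.toReal_nonneg
  exact ⟨(p⁻¹).toReal + e / 4, (q⁻¹).toReal + e / 4, by linarith, by linarith, by linarith,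
    by linarith, by linarith⟩

end Environment

end RCM

/-! ### The maximal inequality in the random environment -/

theorem corollary3 {d : ℕ} (hd : 2 ≤ d) {Ω : Type*} [MeasurableSpace Ω] (P : Measure Ω)
    [IsProbabilityMeasure P] (τ : (Fin d → ℤ) → Ω → Ω) (hτ : RCM.IsStationaryErgodic P τ)
    (C : (Fin d → ℤ) → (Fin d → ℤ) → Ω → ℝ≥0) (hC : RCM.IsConductance P τ C)
    (p q : ℝ≥0∞) (hp : 1 < p) (hq : 1 < q)
    (hμ : MemLp (RCM.muTilde C 2) p P) (hν : MemLp (RCM.nuTilde C) q P)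
    (hpq : (1 - 1 / (d : ℝ)) * (p⁻¹).toReal + (q⁻¹).toReal ≤ 1 / (d : ℝ))
    (m : ℝ) (hm : 2 ≤ m) (hμm : MemLp (RCM.muTilde C m) p P) :
    ∃ C₄ κ₁ : ℝ, 0 < C₄ ∧ 0 < κ₁ ∧
      ∃ N₀ : Ω → ℝ, Measurable N₀ ∧ (∀ ω, 0 < N₀ ω) ∧
        ∀ᵐ ω ∂P, ∀ n : ℕ, N₀ ω < (n : ℝ) → ∀ u : ℝ → (Fin d → ℤ) → ℝ,
          (∃ K : ℝ, ∀ t ∈ Set.Ioc (-(4 * (n : ℝ) ^ 2)) 0, ∀ x, |u t x| ≤ K) →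
          RCM.IsCaloric C ω (4 * (n : ℝ) ^ 2) (2 * (n : ℝ)) u →
          ∀ θ' θ : ℝ, 1 / 2 ≤ θ' → θ' < θ → θ < 1 →
            ∃ a : ℝ,
              IsGreatest ((fun z : ℝ × (Fin d → ℤ) => |u z.1 z.2|) ''
                RCM.cylinder d (θ' * (n : ℝ) ^ 2) (θ' * (n : ℝ))) a ∧
              a ≤ C₄ * ((n : ℝ) ^ (-(m - 2)) * RCM.supNorm ((n : ℝ) ^ 2) u +
                (RCM.M τ C p q m (θ * (n : ℝ)) ω / (θ - θ') ^ (m + 3)) ^ κ₁ *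
                  RCM.stNorm (θ * (n : ℝ) ^ 2) (θ * (n : ℝ)) u) := by
  have hd2 : (2 : ℝ) ≤ d := by exact_mod_cast hd
  have hd0 : (0 : ℝ) < d := by linarith
  have h2d : 2 / (d : ℝ) ≤ 1 := by rw [div_le_one hd0]; exact hd2
  have hp0 : p ≠ 0 := (zero_lt_one.trans hp).ne'
  have hq0 : q ≠ 0 := (zero_lt_one.trans hq).ne'
  obtain ⟨a, b, ha, hb, hpa, hqb, hab⟩ := RCM.exists_exponents hd hp hpq
  set ε := 2 / (d : ℝ) - a - b with hε
  have hε0 : 0 < ε := by linarith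
  set ρ := (1 - 2 / (d : ℝ) + b)⁻¹ with hρ
  have hρ0 : 0 < ρ := inv_pos.2 (by linarith)
  have hρb : ρ⁻¹ = 1 - 2 / (d : ℝ) + b := inv_inv _
  have hsum : a + ρ⁻¹ + ε = 1 := by rw [hρb, hε]; ring
  have hae : 0 < (1 - a) * ε := mul_pos (by linarith) hε0
  set κ₁ := (1 + ε) * ((1 - a) * ε)⁻¹ with hκ₁
  have hκ₁0 : 0 < κ₁ := mul_pos (by linarith) (inv_pos.2 hae)
  set C₄ := RCM.maxConst d m a b ρ ε with hC₄
  have hC₄0 : 0 < C₄ := by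
    have h1 : 0 < RCM.iterConst d a b ρ ε ((m + 3) * (1 + ε)) :=
      RCM.iterConst_pos (by omega) (by linarith) hρ0
    have h2 : 0 < (m + 3) * κ₁ := mul_pos (by linarith) hκ₁0
    rw [hC₄, RCM.maxConst, ← hκ₁]
    positivity
  -- The threshold `1/2` only excludes `n = 0`: the averaged norms stay in the bound, so no ergodic
  -- averaging is awaited.
  refine ⟨C₄, κ₁, hC₄0, hκ₁0, fun _ => 1 / 2, measurable_const, fun _ => by norm_num, ?_⟩
  filter_upwards [hτ.ae_shift (RCM.memLp_ennreal_ae_ne_top hp0 hμm),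
    hτ.ae_shift (RCM.memLp_ennreal_ae_ne_top hq0 hν)] with ω hμω hνω n hn u hb' hcal θ' θ hθ' hθθ hθ
  have hn1 : 1 ≤ n := by
    by_contra! h0
    obtain rfl : n = 0 := by omega
    norm_num at hn
  have hn0 : (0 : ℝ) < n := by exact_mod_cast hn1
  have hn2 : (0 : ℝ) < (n : ℝ) ^ 2 := by positivity
  have hdom := hC.isDominated hm hμω hνω
  have hu := RCM.IsCaloric.isBoundedCaloric hn1 hb' hcal
  have hθ0 : 0 < θ := by linarith
  obtain ⟨⟨t, x⟩, ⟨ht, hx⟩, hgreat⟩ := hu.exists_isGreatest (s := θ' * (n : ℝ) ^ 2) (R := θ' * n)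
    (by positivity) (by nlinarith) (by positivity) (by nlinarith)
  refine ⟨_, hgreat, ?_⟩
  set B := RCM.ball d (θ * n) with hB
  have hθn : θ * n ≤ n := mul_le_of_le_one_left hn0.le hθ.le
  have hBne : B.Nonempty := Finset.card_pos.1 (RCM.card_ball_pos (by positivity))
  have hβ0 : (0 : ℝ) < B.card := by exact_mod_cast hBne.card_pos
  set ps := RCM.avgNorm p B fun x => max (RCM.mu τ C m x ω) 1 with hps
  set qs := RCM.avgNorm q B fun x => max (RCM.nu τ C x ω) 1 with hqs
  have hps1 : 1 ≤ ps := RCM.one_le_avgNorm hBne (fun _ => le_max_right _ _) hp0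
  have hqs1 : 1 ≤ qs := RCM.one_le_avgNorm hBne (fun _ => le_max_right _ _) hq0
  -- The `μ` factor of `M` is at least 1, so the product of the other two suffices.
  have hM : ps * qs ≤ RCM.M τ C p q m (θ * n) ω := by
    rw [RCM.M, ← hB, ← hps, ← hqs, mul_assoc]
    exact le_mul_of_one_le_left (by positivity)
      (RCM.one_le_avgNorm hBne (fun _ => le_max_right _ _) hp0)
  set L := RCM.stNorm (θ * (n : ℝ) ^ 2) (θ * n) u with hL
  have hθn2 : 0 < θ * (n : ℝ) ^ 2 := by positivity
  have hLeq : ∫ t in (-(θ * (n : ℝ) ^ 2))..0, ∑ x ∈ B, |u t x| =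
      θ * (n : ℝ) ^ 2 * (B.card * L) := by
    simp_rw [hL, RCM.stNorm, RCM.avgNorm_one, intervalIntegral.integral_const_mul, ← hB]
    field_simp
  have hL0 : 0 ≤ L := by
    have h1 : 0 ≤ θ * (n : ℝ) ^ 2 * (B.card * L) := by
      rw [← hLeq]
      exact intervalIntegral.integral_nonneg (by linarith) fun t _ =>
        Finset.sum_nonneg fun x _ => abs_nonneg _
    exact nonneg_of_mul_nonneg_right (nonneg_of_mul_nonneg_right h1 hθn2) hβ0
  have hΔ : 0 < (θ - θ') ^ (m + 3) := Real.rpow_pos_of_pos (by linarith) _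
  set Z := (RCM.M τ C p q m (θ * n) ω / (θ - θ') ^ (m + 3)) ^ κ₁ with hZ
  have hpq0 : 0 < ps * qs := by positivity
  have hZle : (ps * qs / (θ - θ') ^ (m + 3)) ^ κ₁ ≤ Z :=
    Real.rpow_le_rpow (by positivity) (div_le_div_of_nonneg_right hM hΔ.le) hκ₁0.le
  have hZ0 : 0 ≤ Z := (Real.rpow_nonneg (by positivity) _).trans hZle
  -- The deterministic inequality needs a positive `L¹` bound, while `L` may vanish; hence `L + e`
  -- with `e` tending to 0.
  have hbound : ∀ e > 0, |u t x| ≤ C₄ * ((n : ℝ) ^ (-(m - 2)) * RCM.supNorm ((n : ℝ) ^ 2) u +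
      Z * (L + e)) := by
    intro e he
    refine (hdom.maximal_inequality hd ha hb (by linarith) hρ0 hρb hε0 hsum hu (θ := θ) (θ' := θ')
      (β := B.card) (ps := ps) (qs := qs) (l := L + e) (by linarith) hθθ hθ hβ0
      (RCM.card_ball_le hn1 hθn)
      (RCM.rpow_sum_le_card_rpow_mul_avgNorm hBne (fun x => hdom.left_nonneg x) hp0 ha hpa)
      (RCM.rpow_sum_le_card_rpow_mul_avgNorm hBne (fun x => hdom.right_nonneg x) hq0 hb hqb)
      hps1 hqs1 (by linarith) ?_ t ht x hx).trans ?_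
    · rw [hLeq]
      have h1 : (B.card : ℝ) * L ≤ B.card * (L + e) :=
        mul_le_mul_of_nonneg_left (by linarith) hβ0.le
      exact mul_le_mul (mul_le_of_le_one_left hn2.le hθ.le) h1 (by positivity) hn2.le
    · refine mul_le_mul_of_nonneg_left ?_ hC₄0.le
      have := mul_le_mul_of_nonneg_right hZle (show 0 ≤ L + e by linarith)
      linarith
  refine le_of_forall_pos_le_add fun e he => ?_
  have hD : 0 < C₄ * Z + 1 := by positivity
  have h1 := hbound (e / (C₄ * Z + 1)) (by positivity)
  have h2 : C₄ * Z * (e / (C₄ * Z + 1)) ≤ e := by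
    rw [mul_div_assoc', div_le_iff₀ hD]
    linarith
  linarith
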